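/- Let $n\ge 2$, and let $F$ be the potential of an $n$-dimensional complex Frobenius manifold in flat coordinates $v^1,\dots,v^n$, with unit $\partial/\partial v^1$ and metric $\eta_{\alpha\beta}=\delta_{\alpha+\beta,n+1}$, expanded at the point $(0,\dots,0,1)$ as a (convergent or merely formal) power series in the coordinates $w^\alpha$ centred at that point; so $\partial_1\partial_\alpha\partial_\beta F=\eta_{\alpha\beta}$ and $F$ satisfies the WDVV equations. Put $c_{\lambda\mu}^\nu=\eta^{\nu\kappa}\partial_\lambda\partial_\mu\partial_\kappa F$. Let $\mathcal F_0(\{t^{d,\mu}\})$ be the associated genus zero descendant potential: the power series that is tame (a monomial of degree $k$ occurs only with weight $\sum d_i\le k-3$), agrees with $F$ up to terms of degree $\le 2$ when $t^{d,\mu}=0$ for $d>0$ and $t^{0,\mu}=w^\mu$, and satisfies the genus zero topological recursion relation. The Hamiltonians of the principal hierarchy are $\theta_{\alpha,p}=\partial^2\mathcal F_0/\partial t^{p,\alpha}\partial t^{0,1}$, regarded as functions of $w$ by restriction to the small phase space $t^{d,\mu}=0$ $(d>0)$, $t^{0,\mu}=w^\mu$. Let $r_1$ be the matrix whose only non-zero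 entry is $(r_1)^1_n=1$, and let $$(r_1z)\hat{\ }=\sum_{d\ge0}t^{d,n}\frac{\partial}{\partial t^{d+1,1}}-\frac{\hbar}{2}\frac{\partial^2}{\partial t^{0,1}\partial t^{0,1}},\qquad \hat R=\exp\big((r_1z)\hat{\ }\big).$$ (i) The infinitesimal deformation of the Hamiltonians, induced by the deformation of $\mathcal F_0$ to the genus zero part (the coefficient of $\hbar^{-1}$) of $Z^{-1}(r_1z)\hat{\ }Z$ with $Z=\exp(\hbar^{-1}\mathcal F_0)$, is $$(r_1z)\hat{\ }\,\theta_{\alpha,p}=U\theta_{\alpha,p}+\delta^n_\alpha\,\theta_{1,p+1},\qquad U=-w^n-\tfrac12\sum_{\gamma=1}^n w^\gamma w^{n+1-\gamma}\frac{\partial}{\partial w^1}+w^n\sum_{\gamma=1}^n w^\gamma\frac{\partial}{\partial w^\gamma}.$$ (ii) There is exactly one series $\hat{\mathcal F}_0$ that is the genus zero part of $\log\hat R(Z)$, that is, $\hat R(Z)=\exp\big(\sum_{g\ge0}\hbar^{g-1}\hat{\mathcal F}_g\big)$ for some power series $\hat{\mathcal F}_g$ in the $t^{d,\mu}$ without constant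 term, where $\hat R(Z)=\sum_k\frac1{k!}\big((r_1z)\hat{\ }\big)^kZ$ converges coefficientwise. Let $\hat\theta_{\alpha,p}$ be the Hamiltonians defined from $\hat{\mathcal F}_0$ as above; these are the $\hat R$-transformed Hamiltonians, and they are series in $\hat v^1,\dots,\hat v^{n-1},\hat v^n+1$. (iii) Let $\theta_{\alpha,p}(v)$ now be any Hamiltonian densities of the principal hierarchy of $F$ near $(0,\dots,0,1)$, i.e. $\partial_\beta\theta_{\alpha,0}=\eta_{\alpha\beta}$ and $\partial_\lambda\partial_\mu\theta_{\alpha,p+1}=c_{\lambda\mu}^\nu\,\partial_\nu\theta_{\alpha,p}$ (whatever further normalization is chosen). Let $\hat v$ be the coordinates of the inverted manifold, so that $$v^1=\frac{\sum_i\hat v^i\hat v^{n+1-i}}{2\hat v^n},\qquad v^\alpha=-\frac{\hat v^\alpha}{\hat v^n}\ (2\le\alpha\le n-1),\qquad v^n=-\frac1{\hat v^n},$$ and let the inversion-transformed Hamiltonians of Liu, Xu and Zhang, as functions of $\hat v$ near $(0,\dots,0,-1)$, be $$\hat\theta^{LXZ}_{1,0}=-\frac1{v^n},\quad \hat\theta^{LXZ}_{1,p}=-\frac{\theta_{n,p-1}(v)}{v^n}\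 (p\ge1),\quad \hat\theta^{LXZ}_{\alpha,p}=\frac{\theta_{\alpha,p}(v)}{v^n}\ (2\le\alpha\le n-1),\quad \hat\theta^{LXZ}_{n,p}=\frac{\theta_{1,p+1}(v)}{v^n}.$$ Then, Hamiltonian densities being taken up to additive constants, the linear spans of the two families coincide: $$\operatorname{span}\{\hat\theta_{\alpha,p}\}+\mathbb C\cdot1=\operatorname{span}\{\hat\theta^{LXZ}_{\alpha,p}\}+\mathbb C\cdot 1 .$$ -/

import Mathlib

open scoped Nat

noncomputable section

namespace InversionHierarchy

/- Conventions.  The flat coordinates are numbered by `Fin n`: the index `0 : Fin n` is the unit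
index `1` of the mathematics, `Fin.rev 0` is the last index `n`, and `Fin.rev α` is `n + 1 - α`.
The metric is `η_{αβ} = δ_{α+β,n+1}`; raising or lowering an index is therefore `Fin.rev`. -/

/-- The antidiagonal metric `η_{αβ} = η^{αβ}`. -/
def eta {n : ℕ} (α β : Fin n) : ℂ := if β = α.rev then 1 else 0

/-- Functions of the flat coordinates near a base point `v₀`, as formal power series in the
shifted coordinates `v^α - v₀^α` (the variables `X α`). -/
abbrev Germ (n : ℕ) : Type := MvPowerSeries (Fin n) ℂ

/-- The partial derivative `∂/∂v^α` on germs. -/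
abbrev dv {n : ℕ} (α : Fin n) (f : Germ n) : Germ n := MvPowerSeries.pderiv ℂ α f

/-- The potential of a Frobenius manifold with flat unit `∂/∂v^1` and metric `η` (a solution of
the WDVV equations; no Euler field, no semisimplicity), near a base point. -/
structure IsFrobeniusPotential {n : ℕ} [NeZero n] (F : Germ n) : Prop where
  unit : ∀ α β, dv 0 (dv α (dv β F)) = MvPowerSeries.C (eta α β)
  wdvv : ∀ α β γ δ,
    ∑ l, ∑ μ, eta l μ • (dv α (dv β (dv l F)) * dv μ (dv γ (dv δ F))) =
    ∑ l, ∑ μ, eta l μ • (dv γ (dv β (dv l F)) * dv μ (dv α (dv δ F)))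

/-- Formal power series in the descendant variables `t^{d,μ}`, over a coefficient ring `R`. -/
abbrev Big (n : ℕ) (R : Type) : Type := MvPowerSeries (ℕ × Fin n) R

/-- The partial derivative `∂/∂t^{d,μ}`. -/
abbrev dt {n : ℕ} {R : Type} [CommRing R] (d : ℕ) (μ : Fin n) (f : Big n R) : Big n R :=
  MvPowerSeries.pderiv R (d, μ) f

/-- Restriction to the small phase space: `t^{d,μ} = 0` for `d > 0` and `t^{0,μ} = v^μ`. -/
def small {n : ℕ} (f : Big n ℂ) : Germ n :=
  fun m => MvPowerSeries.coeff (m.mapDomain fun μ : Fin n => ((0, μ) : ℕ × Fin n)) f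

/-- `F₀` is the genus zero descendant potential of the Frobenius manifold with potential `F`,
expanded at the base point: it is tame (in genus zero a monomial of degree `k` has weight at most
`k - 3`, so in particular there are no terms of degree at most two), its restriction to the small
phase space is `F` up to terms of degree at most two, and it satisfies the genus zero topological
recursion relation.  These conditions determine `F₀`. -/
structure IsDescendantPotential {n : ℕ} (F : Germ n) (F₀ : Big n ℂ) : Prop where
  tame : ∀ m : ℕ × Fin n →₀ ℕ, MvPowerSeries.coeff m F₀ ≠ 0 →
    (m.sum fun x k => k * x.1) + 3 ≤ m.degree
  primary : ∀ m : Fin n →₀ ℕ, 3 ≤ m.degree →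
    MvPowerSeries.coeff m (small F₀) = MvPowerSeries.coeff m F
  trr : ∀ (d₁ d₂ d₃ : ℕ) (α₁ α₂ α₃ : Fin n),
    dt (d₁ + 1) α₁ (dt d₂ α₂ (dt d₃ α₃ F₀)) =
      ∑ l, ∑ σ, eta l σ • (dt d₁ α₁ (dt 0 l F₀) * dt 0 σ (dt d₂ α₂ (dt d₃ α₃ F₀)))

/-- The Hamiltonians of the principal hierarchy, `θ_{α,p} = Ω_{α,p;1,0}` with
`Ω_{α,p;β,q} = ∂²F₀/∂t^{p,α}∂t^{q,β}`, as functions of `v^α = η^{αβ} Ω_{β,0;1,0}`.  On the small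
phase space one has `v^α = t^{0,α}`, so that the function `θ_{α,p}(v)` is read off there. -/
def hamiltonian {n : ℕ} [NeZero n] (F₀ : Big n ℂ) (α : Fin n) (p : ℕ) : Germ n :=
  small (dt p α (dt 0 0 F₀))

/-! ### The Givental action -/

/-- The genus parameter `ħ` in the field of Laurent series. -/
def hbar : LaurentSeries ℂ := HahnSeries.single 1 1

/-- The quantized operator `(r_l z^l)^` acting on series in `t^{d,μ}` with coefficients in
`ℂ((ħ))`; here `r μ ν` is `(r_l)^μ_ν`, and `(r_l)^{μν} = ∑_ρ (r_l)^μ_ρ η^{ρν}`.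
The sum `∑_{d,ν} t^{d,ν} ⋯` is computed coefficientwise: in the coefficient of a monomial `m` only
the variables `t^{d,ν}` dividing `m` contribute. -/
def quantized {n : ℕ} [NeZero n] (l : ℕ) (r : Matrix (Fin n) (Fin n) ℂ)
    (Z : Big n (LaurentSeries ℂ)) : Big n (LaurentSeries ℂ) := fun m =>
  - (∑ μ, r μ 0 • MvPowerSeries.coeff m (dt (l + 1) μ Z))
  + (∑ x ∈ m.support, ∑ μ, r μ x.2 •
      MvPowerSeries.coeff (m - Finsupp.single x 1) (dt (x.1 + l) μ Z))
  + ((1 / 2 : ℂ) • hbar) * ∑ i ∈ Finset.range l, ∑ μ, ∑ ν,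
      ((-1 : ℂ) ^ (i + 1) * ∑ ρ, r μ ρ * eta ρ ν) •
        MvPowerSeries.coeff m (dt i μ (dt (l - 1 - i) ν Z))

/-- The exponential of a power series (with zero constant term). -/
def expS {n : ℕ} (G : Big n (LaurentSeries ℂ)) : Big n (LaurentSeries ℂ) :=
  (PowerSeries.exp ℂ).subst G

/-- `ħ^{-1} 𝓕` for a series `𝓕` without `ħ`. -/
def overHbar {n : ℕ} (f : Big n ℂ) : Big n (LaurentSeries ℂ) :=
  fun m => HahnSeries.single (-1) (MvPowerSeries.coeff m f)

/-- The genus expansion `∑_{g ≥ 0} ħ^{g-1} 𝓕_g`. -/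
def genusSeries {n : ℕ} (f : ℕ → Big n ℂ) : Big n (LaurentSeries ℂ) :=
  fun m => HahnSeries.single (-1) 1 *
    HahnSeries.ofPowerSeries ℤ ℂ (PowerSeries.mk fun g => MvPowerSeries.coeff m (f g))

/-- `Z' = exp(A) Z = ∑_k A^k Z / k!`, the sum converging in every coefficient (of a monomial in
`t` and a power of `ħ`). -/
def IsExpAction {n : ℕ} (A : Big n (LaurentSeries ℂ) → Big n (LaurentSeries ℂ))
    (Z Z' : Big n (LaurentSeries ℂ)) : Prop :=
  ∀ (m : ℕ × Fin n →₀ ℕ) (j : ℤ),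
    HasSum (fun k : ℕ => ((k ! : ℂ))⁻¹ * (MvPowerSeries.coeff m (A^[k] Z)).coeff j)
      ((MvPowerSeries.coeff m Z').coeff j)

/-- The matrix `r₁` of the inversion: the only non-zero entry is `(r₁)^1_n = 1`. -/
def rOne (n : ℕ) [NeZero n] : Matrix (Fin n) (Fin n) ℂ := Matrix.single 0 (Fin.rev 0) 1

/-- `F₀'` is the genus zero part of `log (R̂ exp(ħ^{-1} F₀))`, where `R̂ = exp((r₁ z)^)`. -/
def IsRTransform {n : ℕ} [NeZero n] (F₀ F₀' : Big n ℂ) : Prop :=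
  ∃ f : ℕ → Big n ℂ, f 0 = F₀' ∧ (∀ g, MvPowerSeries.constantCoeff (f g) = 0) ∧
    IsExpAction (quantized 1 (rOne n)) (expS (overHbar F₀)) (expS (genusSeries f))

/-- The infinitesimal deformation of the genus zero potential under `(r₁ z)^`: the genus zero
part of `Z⁻¹ (r₁ z)^ Z` for `Z = exp(ħ^{-1} F₀)`, that is, the genus zero part of the derivative
at `s = 0` of `log (exp(s (r₁ z)^) Z)`. -/
def infDeform {n : ℕ} [NeZero n] (F₀ : Big n ℂ) : Big n ℂ := fun m =>
  (MvPowerSeries.coeff m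
    (expS (- overHbar F₀) * quantized 1 (rOne n) (expS (overHbar F₀)))).coeff (-1)

/-- The operator
`U = -v^n - (1/2) (∑_γ v^γ v^{n+1-γ}) ∂/∂v^1 + v^n ∑_γ v^γ ∂/∂v^γ`
in the coordinates centred at the base point. -/
def opU {n : ℕ} [NeZero n] (f : Germ n) : Germ n :=
  - (MvPowerSeries.X (Fin.rev 0) * f)
  - (1 / 2 : ℂ) • ((∑ γ : Fin n, MvPowerSeries.X γ * MvPowerSeries.X γ.rev) * dv 0 f)
  + MvPowerSeries.X (Fin.rev 0) * ∑ γ : Fin n, MvPowerSeries.X γ * dv γ f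

/-! ### The inversion and the inversion-transformed Hamiltonians -/

/-- `θ` is a system of Hamiltonian densities of the principal hierarchy of the Frobenius manifold
with potential `F`: `θ_{α,0} = η_{αβ} v^β` up to a constant and
`∂_λ ∂_μ θ_{α,p+1} = c_{λμ}^ν ∂_ν θ_{α,p}`.
Further normalizations (orthogonality, `∂θ_{α,p+1}/∂v^1 = θ_{α,p}`) are not imposed. -/
structure IsPrincipalSystem {n : ℕ} (F : Germ n) (θ : Fin n → ℕ → Germ n) : Prop where
  initial : ∀ α β, dv β (θ α 0) = MvPowerSeries.C (eta α β)
  recursion : ∀ (α : Fin n) (p : ℕ) (l μ : Fin n),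
    dv l (dv μ (θ α (p + 1))) =
      ∑ ν, ∑ κ, eta ν κ • (dv l (dv μ (dv κ F)) * dv ν (θ α p))

/-- The base point `(0,…,0,1)` of the original manifold. -/
def basePt (n : ℕ) [NeZero n] (α : Fin n) : ℂ := if α = Fin.rev 0 then 1 else 0

/-- The coordinate functions `v̂^α` of the inverted manifold, expanded at the image
`(0,…,0,-1)` of the base point. -/
def vHat {n : ℕ} [NeZero n] (α : Fin n) : Germ n :=
  MvPowerSeries.X α + MvPowerSeries.C (if α = Fin.rev 0 then -1 else 0)

/-- The inverse inversion: the original coordinates `v^α` as functions of `v̂`,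
`v^1 = (∑_i v̂^i v̂^{n+1-i}) / (2 v̂^n)`, `v^α = -v̂^α / v̂^n`, `v^n = -1 / v̂^n`. -/
def vOfHat {n : ℕ} [NeZero n] (α : Fin n) : Germ n :=
  if α = 0 then (1 / 2 : ℂ) • ((∑ i : Fin n, vHat i * vHat i.rev) * (vHat (Fin.rev 0))⁻¹)
  else if α = Fin.rev 0 then - (vHat (Fin.rev 0))⁻¹
  else - (vHat α * (vHat (Fin.rev 0))⁻¹)

/-- A function `f(v)` near `(0,…,0,1)` as a function of `v̂` near `(0,…,0,-1)`. -/
def pullback {n : ℕ} [NeZero n] (f : Germ n) : Germ n :=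
  MvPowerSeries.subst (fun α : Fin n => vOfHat α - MvPowerSeries.C (basePt n α)) f

/-- The inversion-transformed Hamiltonians of Liu, Xu and Zhang, as functions of `v̂`:
`-1/v^n` and `-θ_{n,p-1}/v^n` for `α = 1`, `θ_{1,p+1}/v^n` for `α = n`, and `θ_{α,p}/v^n`
otherwise. -/
def lxz {n : ℕ} [NeZero n] (θ : Fin n → ℕ → Germ n) (α : Fin n) (p : ℕ) : Germ n :=
  if α = 0 then
    match p with
    | 0 => - (vOfHat (Fin.rev 0))⁻¹
    | q + 1 => - (pullback (θ (Fin.rev 0) q) * (vOfHat (Fin.rev 0))⁻¹)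
  else if α = Fin.rev 0 then pullback (θ 0 (p + 1)) * (vOfHat (Fin.rev 0))⁻¹
  else pullback (θ α p) * (vOfHat (Fin.rev 0))⁻¹

/-- The linear span of a family of Hamiltonians `h_{α,p}`, together with the constant functions
(a Hamiltonian density is defined up to an additive constant). -/
def hamSpan {n : ℕ} (h : Fin n → ℕ → Germ n) : Submodule ℂ (Germ n) :=
  Submodule.span ℂ (Set.range fun x : Fin n × ℕ => h x.1 x.2) ⊔ Submodule.span ℂ {1}

end InversionHierarchy

end

/-! Write `∂` for `∂/∂t^{0,1}` and `S` for the derivation `∑ t^{d,n} ∂/∂t^{d+1,1}`. By the Cole–Hopf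
substitution, `exp(s (r₁z)^) Z` is the exponential of `ħ^{-1} Ψ_s` as soon as `Ψ_s = ∑ ħ^g F_g`
solves `∂_s Ψ = SΨ - (ħ/2) ∂²Ψ - ½ (∂Ψ)²`. Picard iteration solves this equation
(`exists_hamiltonJacobi`), since for a suitable weight each step fixes one more order. The
coefficients are polynomials in `s`, so the series defining `R̂ Z` is, coefficient by coefficient, a
finite Taylor expansion evaluated at `s = 1`. Injectivity of the exponential makes the logarithm
unique (`isRTransform_iff`).

At `ħ = 0` this is a Hamilton–Jacobi equation for the genus zero potential. Restricted to the small
phase space together with `t^{1,1}`, the operator `S` becomes `t^{0,n} ∂/∂t^{1,1}`. The topological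
recursion gives there the dilaton equation for the two-point functions and `(1 - t^{1,1}) ∂F₀ = ½ ∑
t^{0,γ} t^{0,n+1-γ}`. Eliminating `∂/∂t^{1,1}` turns the flow into the operator `U`, which is the
infinitesimal statement (`hamiltonian_infDeform`).

For finite `s` the deformed potential is not shown to satisfy the recursion. Only these two
identities are needed, and they propagate from `s = 0` by uniqueness for linear equations in `s`
(`eq_zero_of_flow`). Hence the deformed Hamiltonians solve `∂_s θ = Uθ`, with source `θ_{1,p+1}`
when `α = n`. Characteristics give the solution `(1 - s v^n) f(v_s)` (`coeffDer_flowSol`). At `s =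
1` the map `v_s` is the inversion and the factor is the reciprocal of the original `v^n`
(`map_one_coordS`), so the transformed Hamiltonians are `θ_{α,p}(v)/v^n`, plus `θ_{1,p+1}(v)/v^n`
when `α = n`.

Two principal systems of `F` have the same span modulo constants, because the recursion fixes each
density up to affine functions of the flat coordinates (`IsPrincipalSystem.hamSpan_eq`). Both
families of the theorem then span the image of that space under `f ↦ f(v)/v^n`. Inversion exchanges
the roles of `1` and `v^n`, and this accounts for the exceptional generator `-1/v^n` and for working
modulo constants. -/

noncomputable section

namespace InversionHierarchy

open MvPowerSeries Finsupp

/-! ### Coefficientwise maps, derivations and degree estimates. -/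

section Generalities

variable {σ τ R S : Type*} [CommRing R] [CommRing S]

/-- Apply an additive map to all coefficients of a power series. -/
def coeffMap (ψ : R →+ S) : MvPowerSeries σ R →+ MvPowerSeries σ S where
  toFun f := fun m => ψ (coeff m f)
  map_zero' := by ext m; exact map_zero ψ
  map_add' f g := by ext m; exact map_add ψ _ _

@[simp] lemma coeff_coeffMap (ψ : R →+ S) (f : MvPowerSeries σ R) (m : σ →₀ ℕ) :
    coeff m (coeffMap ψ f) = ψ (coeff m f) := rfl

lemma mul_natCast_succ (r : R) (k : ℕ) : r * ((k : R) + 1) = (k + 1) • r := by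
  rw [nsmul_eq_mul]; push_cast; ring

lemma map_mul_natCast_succ (ψ : R →+ S) (r : R) (k : ℕ) :
    ψ (r * ((k : R) + 1)) = ψ r * ((k : S) + 1) := by
  rw [mul_natCast_succ, map_nsmul, mul_natCast_succ]

lemma coeffMap_pderiv (ψ : R →+ S) (i : σ) (f : MvPowerSeries σ R) :
    coeffMap ψ (pderiv R i f) = pderiv S i (coeffMap ψ f) := by
  ext m
  simp only [coeff_coeffMap, coeff_pderiv, map_mul_natCast_succ]

lemma coeffMap_killCompl (ψ : R →+ S) (e : σ ↪ τ) (f : MvPowerSeries τ R) :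
    coeffMap ψ (killCompl e f) = killCompl e (coeffMap ψ f) := by
  ext m
  simp only [coeff_coeffMap, coeff_killCompl]

lemma map_eq_coeffMap (ψ : R →+* S) (f : MvPowerSeries σ R) :
    MvPowerSeries.map ψ f = coeffMap (ψ : R →+ S) f := by
  ext m; simp

lemma map_pderiv (ψ : R →+* S) (i : σ) (f : MvPowerSeries σ R) :
    MvPowerSeries.map ψ (pderiv R i f) = pderiv S i (MvPowerSeries.map ψ f) := by
  simp only [map_eq_coeffMap, coeffMap_pderiv]

lemma killCompl_pderiv (e : σ ↪ τ) (i : σ) (f : MvPowerSeries τ R) :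
    killCompl e (pderiv R (e i) f) = pderiv R i (killCompl e f) := by
  ext m
  simp only [coeff_killCompl, coeff_pderiv, embDomain_add, embDomain_single, embDomain_apply_self]

lemma pderiv_comm (i j : σ) (f : MvPowerSeries σ R) :
    pderiv R i (pderiv R j f) = pderiv R j (pderiv R i f) := by
  classical
  ext m
  simp only [coeff_pderiv, add_right_comm m (single i 1)]
  by_cases h : i = j
  · subst h; rfl
  · simp [h, Ne.symm h]
    ring

/-- A derivation of the coefficients, applied coefficientwise. -/
def coeffDer [Algebra S R] (d : Derivation S R R) :
    Derivation S (MvPowerSeries σ R) (MvPowerSeries σ R) :=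
  Derivation.mk'
    { toFun := coeffMap (d : R →+ R)
      map_add' := map_add _
      map_smul' := fun c f => by ext m; simp } <| fun f g => by
    classical
    ext m
    simp only [LinearMap.coe_mk, AddHom.coe_mk, coeff_coeffMap, coeff_mul, map_add, smul_eq_mul,
      mul_comm g, AddMonoidHom.coe_coe, map_sum, Derivation.leibniz, Finset.sum_add_distrib]
    congr 1
    refine Finset.sum_congr rfl fun x _ => mul_comm _ _

lemma coeffDer_apply [Algebra S R] (d : Derivation S R R) (f : MvPowerSeries σ R) :
    coeffDer d f = coeffMap (d : R →+ R) f := rfl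

/-- The coefficients of `δ f` in degree `k` only depend on those of `f` in degrees at most
`k + 1`. -/
def DegreeLocal (δ : MvPowerSeries σ R → MvPowerSeries σ S) : Prop :=
  ∀ f m, (∀ m' : σ →₀ ℕ, m'.degree ≤ m.degree + 1 → coeff m' f = 0) → coeff m (δ f) = 0

lemma degreeLocal_pderiv (i : σ) : DegreeLocal (pderiv R i) := fun f m h => by
  rw [coeff_pderiv, h _ (by simp), zero_mul]

lemma degreeLocal_coeffMap (ψ : R →+ S) : DegreeLocal (coeffMap (σ := σ) ψ) := fun f m h => by
  rw [coeff_coeffMap, h _ (by simp), map_zero]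

lemma degreeLocal_coeffDer [Algebra S R] (d : Derivation S R R) :
    DegreeLocal (coeffDer (σ := σ) d) := fun f m h => degreeLocal_coeffMap (d : R →+ R) f m h

lemma coeff_pow_eq_zero {G : MvPowerSeries σ R} (hG : constantCoeff G = 0) {k : ℕ} {m : σ →₀ ℕ}
    (h : m.degree < k) : coeff m (G ^ k) = 0 :=
  coeff_of_lt_order (lt_of_lt_of_le (by exact_mod_cast h)
    (le_order_pow_of_constantCoeff_eq_zero k hG))

lemma coeff_mul_eq_zero_of_right {f g : MvPowerSeries σ R} {m : σ →₀ ℕ}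
    (h : ∀ m' : σ →₀ ℕ, m'.degree ≤ m.degree → coeff m' g = 0) : coeff m (f * g) = 0 := by
  classical
  rw [coeff_mul]
  refine Finset.sum_eq_zero fun x hx => ?_
  rw [Finset.HasAntidiagonal.mem_antidiagonal] at hx
  rw [h x.2 (by rw [← hx, map_add]; omega), mul_zero]

lemma half_mul_self_der [Algebra ℂ R] (δ : R → R) (h0 : ∀ x y, δ (x + y) = δ x + δ y)
    (h : ∀ x y, δ (x * y) = x * δ y + y * δ x) (p : R) :
    δ ((1 / 2 : ℂ) • (p * p)) = p * δ p := by
  have h1 : δ ((1 / 2 : ℂ) • (p * p)) + δ ((1 / 2 : ℂ) • (p * p)) = p * δ p + p * δ p := by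
    rw [← h0, ← h, ← add_smul]; norm_num
  rw [← two_smul ℂ, ← two_smul ℂ (p * δ p)] at h1
  have := congrArg (fun x => (1 / 2 : ℂ) • x) h1
  simpa [smul_smul] using this

lemma coeff_smul_complex [Algebra ℂ R] (c : ℂ) (f : MvPowerSeries σ R) (m : σ →₀ ℕ) :
    coeff m (c • f) = c • coeff m f := rfl

end Generalities

/-! ### The formal exponential. -/

section Exponential

variable {σ R S : Type*} [CommRing R] [Algebra ℂ R] [CommRing S] [Algebra ℂ S]

/-- The exponential of a power series without constant term. -/
def expo (G : MvPowerSeries σ R) : MvPowerSeries σ R := (PowerSeries.exp ℂ).subst G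

/-- The partial sums of the exponential series. -/
def expoPartial (G : MvPowerSeries σ R) (N : ℕ) : MvPowerSeries σ R :=
  ∑ k ∈ Finset.range N, ((k ! : ℂ)⁻¹) • G ^ k

lemma coeff_expo {G : MvPowerSeries σ R} (hG : constantCoeff G = 0) {m : σ →₀ ℕ} {N : ℕ}
    (h : m.degree < N) : coeff m (expo G) = coeff m (expoPartial G N) := by
  rw [expo, PowerSeries.coeff_subst (PowerSeries.HasSubst.of_constantCoeff_zero hG),
    expoPartial, map_sum, finsum_eq_sum_of_support_subset (s := Finset.range N)]
  · refine Finset.sum_congr rfl fun k _ => ?_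
    simp [PowerSeries.coeff_exp]
  · intro k hk
    by_contra hkN
    simp only [Finset.coe_range, Set.mem_Iio, not_lt] at hkN
    exact hk (by simp [coeff_pow_eq_zero hG (h.trans_le hkN)])

lemma constantCoeff_expo {G : MvPowerSeries σ R} (hG : constantCoeff G = 0) :
    constantCoeff (expo G) = 1 := by
  rw [← coeff_zero_eq_constantCoeff_apply, coeff_expo hG (N := 1) (by simp)]
  simp [expoPartial]

lemma der_expoPartial (δ : Derivation ℂ (MvPowerSeries σ R) (MvPowerSeries σ R))
    (G : MvPowerSeries σ R) (N : ℕ) :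
    δ (expoPartial G (N + 1)) = δ G * expoPartial G N := by
  rw [expoPartial, Finset.sum_range_succ', map_add, map_sum, expoPartial, Finset.mul_sum]
  simp only [pow_zero, Derivation.map_smul, Derivation.map_one_eq_zero, smul_zero, add_zero]
  refine Finset.sum_congr rfl fun k _ => ?_
  rw [Derivation.leibniz_pow, Nat.add_sub_cancel, smul_eq_mul, mul_comm (G ^ k),
    ← Nat.cast_smul_eq_nsmul ℂ, smul_smul, mul_smul_comm, Nat.factorial_succ]
  congr 1
  have : ((k : ℂ) + 1) ≠ 0 := by exact_mod_cast k.succ_ne_zero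
  have : (k ! : ℂ) ≠ 0 := by exact_mod_cast k.factorial_ne_zero
  push_cast
  field_simp

/-- A derivation need not commute with infinite sums. Degree locality makes each coefficient depend
on a partial sum only, where the Leibniz rule suffices; one extra term pays for the degree that `δ`
may lower. -/
lemma der_expo (δ : Derivation ℂ (MvPowerSeries σ R) (MvPowerSeries σ R)) (hδ : DegreeLocal δ)
    {G : MvPowerSeries σ R} (hG : constantCoeff G = 0) : δ (expo G) = δ G * expo G := by
  ext m
  have h1 : coeff m (δ (expo G - expoPartial G (m.degree + 1 + 1))) = 0 :=
    hδ _ _ fun m' hm' => by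
      rw [map_sub, coeff_expo hG (Nat.lt_succ_of_le hm'), sub_self]
  have h2 : coeff m (δ G * (expo G - expoPartial G (m.degree + 1))) = 0 :=
    coeff_mul_eq_zero_of_right fun m' hm' => by
      rw [map_sub, coeff_expo hG (Nat.lt_succ_of_le hm'), sub_self]
  rw [map_sub, der_expoPartial, map_sub, sub_eq_zero] at h1
  rw [mul_sub, map_sub, sub_eq_zero] at h2
  rw [h1, h2]

lemma map_expo (ψ : R →ₐ[ℂ] S) {G : MvPowerSeries σ R} (hG : constantCoeff G = 0) :
    MvPowerSeries.map (ψ : R →+* S) (expo G) = expo (MvPowerSeries.map (ψ : R →+* S) G) := by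
  ext m
  have hG' : constantCoeff (MvPowerSeries.map (ψ : R →+* S) G) = 0 := by
    rw [constantCoeff_map, hG, map_zero]
  rw [coeff_map, coeff_expo hG (Nat.lt_succ_self _), coeff_expo hG' (Nat.lt_succ_self _)]
  simp only [expoPartial, map_sum, ← map_pow]
  refine Finset.sum_congr rfl fun k _ => ?_
  exact map_smul ψ _ _

/-- The partial derivative as a derivation over the complex numbers. -/
def pderivC (i : σ) : Derivation ℂ (MvPowerSeries σ R) (MvPowerSeries σ R) :=
  (pderiv R i).restrictScalars ℂ

lemma pderivC_apply (i : σ) (f : MvPowerSeries σ R) : pderivC i f = pderiv R i f := rfl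

lemma pderiv_expo (i : σ) {G : MvPowerSeries σ R} (hG : constantCoeff G = 0) :
    pderiv R i (expo G) = pderiv R i G * expo G := by
  have h : DegreeLocal (pderivC (R := R) i) := fun f m h => by
    rw [pderivC_apply]; exact degreeLocal_pderiv i f m h
  simpa only [pderivC_apply] using der_expo (pderivC i) h hG

variable [IsAddTorsionFree R]

lemma expo_neg_mul_expo {G : MvPowerSeries σ R} (hG : constantCoeff G = 0) :
    expo (-G) * expo G = 1 := by
  have hG' : constantCoeff (-G) = 0 := by rw [map_neg, hG, neg_zero]
  refine pderiv.ext (fun i => ?_) ?_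
  · rw [Derivation.leibniz, pderiv_expo i hG, pderiv_expo i hG', pderiv_one, map_neg]
    simp only [smul_eq_mul]; ring
  · rw [map_mul, constantCoeff_expo hG, constantCoeff_expo hG', map_one, one_mul]

/-- The logarithmic derivative recovers every `∂G` from `exp G`, and a series over a torsion-free
ring is determined by its partial derivatives and its constant term. -/
lemma expo_injective {G H : MvPowerSeries σ R} (hG : constantCoeff G = 0)
    (hH : constantCoeff H = 0) (h : expo G = expo H) : G = H := by
  refine pderiv.ext (fun i => ?_) (hG.trans hH.symm)
  have h1 := pderiv_expo i hG
  rw [h, pderiv_expo i hH] at h1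
  have := congrArg (· * expo (-H)) h1
  simpa only [mul_assoc, mul_comm (expo H), expo_neg_mul_expo hH, mul_one] using this.symm

end Exponential

end InversionHierarchy
end

noncomputable section

namespace InversionHierarchy

open MvPowerSeries Finsupp

/-! ### The operator `(r₁z)^` as a shift derivation plus a Laplacian. -/

section Shift

variable {n : ℕ} [NeZero n] {R S : Type} [CommRing R] [CommRing S]

/-- The partial sums of the derivation `∑_d t^{d,n} ∂/∂t^{d+1,1}`. -/
def shiftPartial (N : ℕ) : Derivation R (Big n R) (Big n R) :=
  ∑ d ∈ Finset.range N, (X (d, Fin.rev 0) : Big n R) • pderiv R ((d + 1, 0) : ℕ × Fin n)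

lemma shiftPartial_apply (N : ℕ) (f : Big n R) :
    shiftPartial N f =
      ∑ d ∈ Finset.range N, X (d, Fin.rev 0) * pderiv R ((d + 1, 0) : ℕ × Fin n) f := by
  rw [shiftPartial, ← Derivation.coeFnAddMonoidHom_apply, map_sum, Finset.sum_apply]
  rfl

/-- The coefficients of `∑_d t^{d,n} ∂f/∂t^{d+1,1}`. -/
def shiftFun (f : Big n R) : Big n R := fun m =>
  ∑ x ∈ m.support, if x.2 = Fin.rev 0 then
    coeff (m - single x 1) (pderiv R ((x.1 + 1, 0) : ℕ × Fin n) f) else 0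

lemma coeff_shiftFun (f : Big n R) (m : ℕ × Fin n →₀ ℕ) : coeff m (shiftFun f) =
    ∑ x ∈ m.support, if x.2 = Fin.rev 0 then
      coeff (m - single x 1) (pderiv R ((x.1 + 1, 0) : ℕ × Fin n) f) else 0 := rfl

/-- `N` bounds the levels `d` of the variables `t^{d,n}` in the monomial `m`. -/
def LevelBound (N : ℕ) (m : ℕ × Fin n →₀ ℕ) : Prop := ∀ d, N ≤ d → m (d, Fin.rev 0) = 0

lemma exists_levelBound (k : ℕ) (m : ℕ × Fin n →₀ ℕ) : ∃ N, k ≤ N ∧ LevelBound N m := by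
  refine ⟨max k (m.support.sup Prod.fst + 1), le_max_left _ _, fun d hd => ?_⟩
  by_contra h
  have := Finset.le_sup (f := Prod.fst) (Finsupp.mem_support_iff.mpr h)
  have := le_trans (le_max_right k _) hd
  simp only at *
  omega

lemma LevelBound.mono {N : ℕ} {m m' : ℕ × Fin n →₀ ℕ} (h : LevelBound N m) (hm : m' ≤ m) :
    LevelBound N m' := fun d hd => Nat.le_zero.mp ((hm _).trans_eq (h d hd))

/-- The infinite sum over `d` is finite at each monomial. Since the bound on levels is inherited by
divisors, identities such as the Leibniz rule can be checked on the partial sums. -/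
lemma coeff_shiftFun_eq {N : ℕ} {m : ℕ × Fin n →₀ ℕ} (h : LevelBound N m) (f : Big n R) :
    coeff m (shiftFun f) = coeff m (shiftPartial N f) := by
  classical
  rw [coeff_shiftFun, shiftPartial_apply, map_sum, ← Finset.sum_filter]
  have hX (d : ℕ) : coeff m (X (d, Fin.rev 0) * pderiv R ((d + 1, 0) : ℕ × Fin n) f) =
      if m (d, Fin.rev 0) ≠ 0 then
        coeff (m - single (d, Fin.rev 0) 1) (pderiv R ((d + 1, 0) : ℕ × Fin n) f) else 0 := by
    rw [X_def, coeff_monomial_mul, one_mul]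
    simp only [single_le_iff, Nat.one_le_iff_ne_zero]
  simp only [hX]
  rw [← Finset.sum_filter]
  refine Finset.sum_bij' (fun x _ => x.1) (fun d _ => (d, Fin.rev 0)) ?_ ?_ ?_ ?_ ?_
  · rintro ⟨d, μ⟩ hx
    simp only [Finset.mem_filter, mem_support_iff] at hx
    obtain ⟨hx, rfl⟩ := hx
    simp only [Finset.mem_filter, Finset.mem_range]
    exact ⟨by by_contra hd; exact hx (h d (not_lt.mp hd)), hx⟩
  · intro d hd
    simp only [Finset.mem_filter, mem_support_iff] at hd ⊢
    exact ⟨hd.2, trivial⟩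
  · rintro ⟨d, μ⟩ hx
    simp only [Finset.mem_filter] at hx
    rw [← hx.2]
  · intro d _; rfl
  · rintro ⟨d, μ⟩ hx
    simp only [Finset.mem_filter] at hx
    rw [← hx.2]

lemma coeff_mul_congr {σ : Type*} {f g g' : MvPowerSeries σ R} {m : σ →₀ ℕ}
    (h : ∀ m' ≤ m, coeff m' g = coeff m' g') : coeff m (f * g) = coeff m (f * g') := by
  classical
  rw [coeff_mul, coeff_mul]
  refine Finset.sum_congr rfl fun x hx => ?_
  rw [Finset.HasAntidiagonal.mem_antidiagonal] at hx
  rw [h x.2 (by rw [← hx]; exact le_add_self)]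

/-- The derivation `∑_d t^{d,n} ∂/∂t^{d+1,1}`, the classical part of `(r₁ z)^`. -/
def shiftOp : Derivation R (Big n R) (Big n R) :=
  Derivation.mk'
    { toFun := shiftFun
      map_add' := fun f g => by
        ext m
        obtain ⟨N, -, h⟩ := exists_levelBound 0 m
        simp only [map_add, coeff_shiftFun_eq h]
      map_smul' := fun c f => by
        ext m
        obtain ⟨N, -, h⟩ := exists_levelBound 0 m
        simp only [coeff_smul, coeff_shiftFun_eq h, Derivation.map_smul, RingHom.id_apply] } <|
  fun f g => by
    ext m
    obtain ⟨N, -, h⟩ := exists_levelBound 0 m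
    simp only [LinearMap.coe_mk, AddHom.coe_mk, smul_eq_mul, map_add]
    rw [coeff_shiftFun_eq h, Derivation.leibniz, map_add, smul_eq_mul, smul_eq_mul]
    congr 1 <;>
    exact (coeff_mul_congr fun m' hm' => coeff_shiftFun_eq (h.mono hm') _).symm

lemma shiftOp_apply (f : Big n R) : shiftOp f = shiftFun f := rfl

lemma coeff_shiftOp {N : ℕ} {m : ℕ × Fin n →₀ ℕ} (h : LevelBound N m) (f : Big n R) :
    coeff m (shiftOp f) = coeff m (shiftPartial N f) := coeff_shiftFun_eq h f

lemma degreeLocal_shiftOp : DegreeLocal (shiftOp : Big n R → Big n R) := fun f m h => by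
  rw [shiftOp_apply, coeff_shiftFun]
  refine Finset.sum_eq_zero fun x _ => ?_
  split_ifs
  · refine degreeLocal_pderiv _ _ _ fun m' hm' => h _ (hm'.trans ?_)
    exact Nat.add_le_add_right (Finsupp.degree_mono tsub_le_self) 1
  · rfl

lemma coeffMap_shiftOp (ψ : R →+ S) (f : Big n R) :
    coeffMap ψ (shiftOp f) = shiftOp (coeffMap ψ f) := by
  ext m
  simp only [coeff_coeffMap, shiftOp_apply, coeff_shiftFun, map_sum]
  refine Finset.sum_congr rfl fun x _ => ?_
  rw [← coeffMap_pderiv, coeff_coeffMap]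
  split_ifs <;> simp

lemma map_shiftOp (ψ : R →+* S) (f : Big n R) :
    MvPowerSeries.map ψ (shiftOp f) = shiftOp (MvPowerSeries.map ψ f) := by
  simp only [map_eq_coeffMap, coeffMap_shiftOp]

/-- The commutator with `∂/∂t^{q,α}` comes from the single coefficient `t^{q,n}`. It is the origin
of the source term `δ^n_α θ_{1,p+1}`. -/
lemma pderiv_shiftOp (q : ℕ) (α : Fin n) (f : Big n R) :
    pderiv R (q, α) (shiftOp f) = shiftOp (pderiv R (q, α) f) +
      if α = Fin.rev 0 then pderiv R (q + 1, 0) f else 0 := by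
  classical
  ext m
  obtain ⟨N, hN, h⟩ := exists_levelBound (q + 1) (m + single (q, α) 1)
  have h' : LevelBound N m := h.mono le_self_add
  rw [coeff_pderiv, coeff_shiftOp h, ← coeff_pderiv, map_add, coeff_shiftOp h',
    shiftPartial_apply, shiftPartial_apply, map_sum, ← map_add]
  congr 1
  simp only [Derivation.leibniz, smul_eq_mul, Finset.sum_add_distrib,
    pderiv_comm (q, α)]
  congr 1
  split_ifs with hα
  · subst hα
    rw [Finset.sum_eq_single q]
    · simp
    · intro d _ hd
      rw [pderiv_X_of_ne (by simpa using hd), mul_zero]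
    · intro hq
      exact absurd (Finset.mem_range.mpr hN) hq
  · refine Finset.sum_eq_zero fun d _ => ?_
    rw [pderiv_X_of_ne (by simp [Ne.symm hα]), mul_zero]

/-- The operator `∑_d t^{d,n} ∂/∂t^{d+1,1} - (h/2) ∂²/∂t^{0,1}∂t^{0,1}`. -/
def heatOp [Algebra ℂ R] (h : R) (f : Big n R) : Big n R :=
  shiftOp f - C ((1 / 2 : ℂ) • h) * dt 0 0 (dt 0 0 f)

lemma rev_zero_ne (hn : 2 ≤ n) : Fin.rev (0 : Fin n) ≠ 0 := by
  intro h
  have := congrArg Fin.val h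
  simp [Fin.val_rev] at this
  omega

/-- The dilaton shift contributes only through the first column of `r₁`, which vanishes because `n ≥
2`; raising the last index of `r₁` leaves `(r₁)^{11} = 1` as the only second-order coefficient. -/
lemma coeff_heatOp [Algebra ℂ R] (hn : 2 ≤ n) (h : R) (Z : Big n R) (m : ℕ × Fin n →₀ ℕ) :
    - (∑ μ, rOne n μ 0 • coeff m (dt (1 + 1) μ Z))
      + (∑ x ∈ m.support, ∑ μ, rOne n μ x.2 • coeff (m - single x 1) (dt (x.1 + 1) μ Z))
      + ((1 / 2 : ℂ) • h) * ∑ i ∈ Finset.range 1, ∑ μ, ∑ ν,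
          ((-1 : ℂ) ^ (i + 1) * ∑ ρ, rOne n μ ρ * eta ρ ν) •
            coeff m (dt i μ (dt (1 - 1 - i) ν Z)) = coeff m (heatOp h Z) := by
  have h0 := rev_zero_ne hn
  rw [heatOp, map_sub, coeff_C_mul, shiftOp_apply, coeff_shiftFun]
  have hr (μ ν : Fin n) : rOne n μ ν = if 0 = μ ∧ Fin.rev 0 = ν then 1 else 0 := by
    simp [rOne, Matrix.single_apply]
  have e1 : ∑ μ, rOne n μ 0 • coeff m (dt (1 + 1) μ Z) = 0 :=
    Finset.sum_eq_zero fun μ _ => by simp [hr, h0]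
  have e2 : ∑ x ∈ m.support, ∑ μ, rOne n μ x.2 • coeff (m - single x 1) (dt (x.1 + 1) μ Z) =
      ∑ x ∈ m.support, if x.2 = Fin.rev 0 then
        coeff (m - single x 1) (pderiv R ((x.1 + 1, 0) : ℕ × Fin n) Z) else 0 := by
    refine Finset.sum_congr rfl fun x _ => ?_
    rw [Finset.sum_eq_single 0]
    · simp [hr, eq_comm]
    · intro μ _ hμ; simp [hr, Ne.symm hμ]
    · simp
  have er (ν : Fin n) : ∑ ρ, rOne n 0 ρ * eta ρ ν = if ν = 0 then 1 else 0 := by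
    rw [Finset.sum_eq_single (Fin.rev 0)]
    · simp [hr, eta]
    · intro ρ _ hρ; simp [hr, Ne.symm hρ]
    · simp
  have e3 : ∑ i ∈ Finset.range 1, ∑ μ, ∑ ν,
          ((-1 : ℂ) ^ (i + 1) * ∑ ρ, rOne n μ ρ * eta ρ ν) •
            coeff m (dt i μ (dt (1 - 1 - i) ν Z)) = - coeff m (dt 0 0 (dt 0 0 Z)) := by
    rw [Finset.sum_range_one, Finset.sum_eq_single 0, Finset.sum_eq_single 0]
    · simp [er]
    · intro ν _ hν
      simp [er, hν]
    · simp
    · intro μ _ hμ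
      simp [hr, Ne.symm hμ]
    · simp
  rw [e1, e2, e3, neg_zero, zero_add, mul_neg, sub_eq_add_neg]

end Shift

section HeatExp

variable {n : ℕ} [NeZero n] {R : Type} [CommRing R] [Algebra ℂ R]

lemma shiftOp_expo {G : Big n R} (hG : constantCoeff G = 0) :
    shiftOp (expo G) = shiftOp G * expo G := by
  have h : DegreeLocal (shiftOp.restrictScalars ℂ : Derivation ℂ (Big n R) (Big n R)) :=
    fun f m h => by
      rw [Derivation.restrictScalars_apply]; exact degreeLocal_shiftOp f m h
  simpa only [Derivation.restrictScalars_apply] using der_expo (shiftOp.restrictScalars ℂ) h hG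

/-- The Cole–Hopf computation: the linear operator on `exp G` becomes a quadratic one on `G`. -/
lemma heatOp_expo (h : R) {G : Big n R} (hG : constantCoeff G = 0) :
    heatOp h (expo G) =
      (shiftOp G - C ((1 / 2 : ℂ) • h) * (dt 0 0 (dt 0 0 G) + dt 0 0 G * dt 0 0 G)) * expo G := by
  simp only [heatOp, dt]
  rw [shiftOp_expo hG, pderiv_expo _ hG, Derivation.leibniz, pderiv_expo _ hG]
  simp only [smul_eq_mul]
  ring

end HeatExp

/-! ### Two presentations of Laurent series in `ħ`. -/

section Laurent

/-- The ring of Laurent series in `ħ`, with its coefficientwise `ℂ`-algebra structure. -/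
def Laur (R : Type) [CommRing R] : Type := HahnSeries ℤ R

instance (R : Type) [CommRing R] : CommRing (Laur R) :=
  inferInstanceAs (CommRing (HahnSeries ℤ R))

instance (R : Type) [CommRing R] [Algebra ℂ R] : Algebra ℂ (Laur R) :=
  (HahnSeries.instAlgebra : Algebra ℂ (HahnSeries ℤ R))

/-- The exponential in the theorem uses the algebra structure inherited from power series, whereas
the proof uses the coefficientwise one, available over any coefficient ring. This identification
allows passing between them. -/
lemma algebra_laurent_eq :
    (inferInstance : Algebra ℂ (LaurentSeries ℂ)) = (inferInstance : Algebra ℂ (Laur ℂ)) := by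
  refine Algebra.algebra_ext _ _ fun c => ?_
  rw [HahnSeries.algebraMap_apply']
  exact HahnSeries.ofPowerSeries_C c

lemma expS_eq {n : ℕ} (G : Big n (LaurentSeries ℂ)) : expS G = expo (R := Laur ℂ) G := by
  have h (i j : Algebra ℂ (LaurentSeries ℂ)) (hij : i = j) :
      @expo _ (LaurentSeries ℂ) _ i G = @expo _ (LaurentSeries ℂ) _ j G := by rw [hij]
  exact h _ _ algebra_laurent_eq

lemma quantized_rOne {n : ℕ} [NeZero n] (hn : 2 ≤ n) :
    quantized 1 (rOne n) = heatOp (R := Laur ℂ) hbar := by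
  funext Z
  ext1 m
  exact coeff_heatOp (R := Laur ℂ) hn hbar Z m

end Laurent

end InversionHierarchy
end

noncomputable section

namespace InversionHierarchy

open MvPowerSeries Finsupp

/-! ### Picard iteration for the Hamilton–Jacobi hierarchy. -/

section Picard

variable {n : ℕ} [NeZero n] {R : Type} [CommRing R]

/-- The weight in which `t^{0,1}` has weight zero, `t^{d,n}` has weight two and all other
variables have weight one. -/
def wt : (ℕ × Fin n →₀ ℕ) →+ ℕ :=
  Finsupp.weight fun x => if x = (0, 0) then 0 else if x.2 = Fin.rev 0 then 2 else 1

lemma wt_single (x : ℕ × Fin n) :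
    wt (single x 1) = if x = (0, 0) then 0 else if x.2 = Fin.rev 0 then 2 else 1 := by
  simp [wt, Finsupp.weight_apply]

/-- The series vanishes on the axis of the variable `t^{0,1}`. -/
def VanishesOnAxis (f : Big n R) : Prop := ∀ m, wt m = 0 → coeff m f = 0

/-- The two series agree up to terms of weight at least `k`, the genus parameter having
weight one. -/
def AgreeBelow (k : ℕ) (f g : Big n (PowerSeries R)) : Prop :=
  ∀ m j, wt m + j < k → PowerSeries.coeff j (coeff m f) = PowerSeries.coeff j (coeff m g)

lemma AgreeBelow.trans {k : ℕ} {f g h : Big n (PowerSeries R)} (h₁ : AgreeBelow k f g)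
    (h₂ : AgreeBelow k g h) : AgreeBelow k f h := fun m j hj => (h₁ m j hj).trans (h₂ m j hj)

lemma AgreeBelow.mono {k l : ℕ} (hl : l ≤ k) {f g : Big n (PowerSeries R)}
    (h : AgreeBelow k f g) : AgreeBelow l f g := fun m j hj => h m j (hj.trans_le hl)

lemma AgreeBelow.sub {k : ℕ} {f g f' g' : Big n (PowerSeries R)} (h : AgreeBelow k f g)
    (h' : AgreeBelow k f' g') : AgreeBelow k (f - f') (g - g') := fun m j hj => by
  simp only [map_sub, h m j hj, h' m j hj]

omit [NeZero n] in
lemma coeff_coeff_pderiv (x : ℕ × Fin n) (f : Big n (PowerSeries R)) (m : ℕ × Fin n →₀ ℕ)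
    (j : ℕ) : PowerSeries.coeff j (coeff m (pderiv (PowerSeries R) x f)) =
      PowerSeries.coeff j (coeff (m + single x 1) f) * ((m x : R) + 1) := by
  rw [coeff_pderiv]
  exact map_mul_natCast_succ (PowerSeries.coeff (R := R) j : PowerSeries R →+ R) _ _

lemma VanishesOnAxis.dt {f : Big n R} (h : VanishesOnAxis f) : VanishesOnAxis (dt 0 0 f) :=
  fun m hm => by
    rw [InversionHierarchy.dt, coeff_pderiv, h _ (by simp [wt_single, hm]), zero_mul]

lemma AgreeBelow.dt {k : ℕ} {f g : Big n (PowerSeries R)} (h : AgreeBelow k f g) :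
    AgreeBelow k (dt 0 0 f) (dt 0 0 g) := fun m j hj => by
  rw [InversionHierarchy.dt, InversionHierarchy.dt, coeff_coeff_pderiv, coeff_coeff_pderiv,
    h _ _ (by simpa [wt_single] using hj)]

lemma VanishesOnAxis.shiftOp {f : Big n R} (hn : 2 ≤ n) : VanishesOnAxis (shiftOp f) :=
  fun m hm => by
    rw [shiftOp_apply, coeff_shiftFun]
    refine Finset.sum_eq_zero fun x hx => if_neg fun hx2 => ?_
    have h1 : single x 1 ≤ m := by
      rw [single_le_iff]; exact Nat.one_le_iff_ne_zero.mpr (Finsupp.mem_support_iff.mp hx)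
    have h2 : wt m = wt (m - single x 1) + wt (single x 1) := by
      rw [← map_add, tsub_add_cancel_of_le h1]
    have h3 : x ≠ (0, 0) := fun h => rev_zero_ne hn (by rw [← hx2, h])
    rw [wt_single, if_neg h3, if_pos hx2] at h2
    omega

/-- The shift trades `t^{d+1,1}`, of weight one, for `t^{d,n}`, of weight two, so it gains one
order. -/
lemma AgreeBelow.shiftOp (hn : 2 ≤ n) {k : ℕ} {f g : Big n (PowerSeries R)}
    (h : AgreeBelow k f g) : AgreeBelow (k + 1) (shiftOp f) (shiftOp g) := fun m j hj => by
  simp only [shiftOp_apply, coeff_shiftFun, map_sum]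
  refine Finset.sum_congr rfl fun x hx => ?_
  split_ifs with hx2
  · have h1 : single x 1 ≤ m := by
      rw [single_le_iff]; exact Nat.one_le_iff_ne_zero.mpr (Finsupp.mem_support_iff.mp hx)
    have h2 : wt m = wt (m - single x 1) + wt (single x 1) := by
      rw [← map_add, tsub_add_cancel_of_le h1]
    have h3 : x ≠ (0, 0) := fun h => rev_zero_ne hn (by rw [← hx2, h])
    rw [wt_single, if_neg h3, if_pos hx2] at h2
    rw [coeff_coeff_pderiv, coeff_coeff_pderiv, h]
    rw [map_add, wt_single, if_neg (by simp), if_neg (Ne.symm (rev_zero_ne hn))]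
    omega
  · rfl

lemma AgreeBelow.C_mul [Algebra ℂ R] {k : ℕ} {f g : Big n (PowerSeries R)}
    (h : AgreeBelow k f g) : AgreeBelow (k + 1) (C ((1 / 2 : ℂ) • PowerSeries.X) * f)
      (C ((1 / 2 : ℂ) • PowerSeries.X) * g) := fun m j hj => by
  rw [coeff_C_mul, coeff_C_mul, smul_mul_assoc, smul_mul_assoc]
  cases j with
  | zero => simp
  | succ j =>
    simp only [PowerSeries.coeff_smul, PowerSeries.coeff_succ_X_mul]
    rw [h m j (by omega)]

lemma VanishesOnAxis.mul {f : Big n R} (h : VanishesOnAxis f) (g : Big n R) :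
    VanishesOnAxis (f * g) := fun m hm => by
  classical
  rw [coeff_mul]
  refine Finset.sum_eq_zero fun x hx => ?_
  rw [Finset.HasAntidiagonal.mem_antidiagonal] at hx
  have := congrArg wt hx
  rw [map_add] at this
  rw [h x.1 (by omega), zero_mul]

/-- Vanishing on the axis leaves only products in which both factors have positive weight. Each
factor then has order strictly below that of the product, which gains one order for the quadratic
term. -/
lemma AgreeBelow.mul_self {k : ℕ} {f g : Big n (PowerSeries R)} (h : AgreeBelow k f g)
    (hf : VanishesOnAxis f) (hg : VanishesOnAxis g) : AgreeBelow (k + 1) (f * f) (g * g) :=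
  fun m j hj => by
    classical
    rw [coeff_mul, coeff_mul, map_sum, map_sum]
    refine Finset.sum_congr rfl fun x hx => ?_
    rw [Finset.HasAntidiagonal.mem_antidiagonal] at hx
    have hx' := congrArg wt hx
    rw [map_add] at hx'
    by_cases h1 : wt x.1 = 0
    · rw [hf _ h1, hg _ h1]; simp
    by_cases h2 : wt x.2 = 0
    · rw [hf _ h2, hg _ h2]; simp
    rw [PowerSeries.coeff_mul, PowerSeries.coeff_mul]
    refine Finset.sum_congr rfl fun y hy => ?_
    rw [Finset.HasAntidiagonal.mem_antidiagonal] at hy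
    rw [h x.1 y.1 (by omega), h x.2 y.2 (by omega)]

variable [Algebra ℂ R]

/-- The right hand side of the Hamilton–Jacobi hierarchy
`∂Ψ/∂s = ∑_d t^{d,n} ∂Ψ/∂t^{d+1,1} - (ħ/2) ∂²Ψ - (1/2) (∂Ψ)²` for `Ψ = ∑_g ħ^g F_g`. -/
def hjRhs (f : Big n (PowerSeries R)) : Big n (PowerSeries R) :=
  heatOp PowerSeries.X f - (1 / 2 : ℂ) • (dt 0 0 f * dt 0 0 f)

lemma vanishesOnAxis_hjRhs (hn : 2 ≤ n) {f : Big n (PowerSeries R)} (h : VanishesOnAxis f) :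
    VanishesOnAxis (hjRhs f) := fun m hm => by
  rw [hjRhs, heatOp, map_sub, map_sub, VanishesOnAxis.shiftOp hn m hm, coeff_C_mul,
    h.dt.dt m hm, mul_zero, sub_zero, zero_sub, coeff_smul_complex, h.dt.mul _ m hm, smul_zero, neg_zero]

lemma AgreeBelow.hjRhs (hn : 2 ≤ n) {k : ℕ} {f g : Big n (PowerSeries R)}
    (h : AgreeBelow k f g) (hf : VanishesOnAxis f) (hg : VanishesOnAxis g) :
    AgreeBelow (k + 1) (hjRhs f) (hjRhs g) := by
  refine ((h.shiftOp hn).sub h.dt.dt.C_mul).sub fun m j hj => ?_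
  have hc (c : ℂ) (p : PowerSeries R) :
      PowerSeries.coeff j (c • p) = c • PowerSeries.coeff j p := rfl
  rw [coeff_smul_complex, coeff_smul_complex, hc, hc, h.dt.mul_self hf.dt hg.dt m j hj]

variable (J : R →+ R) (f₀ : Big n (PowerSeries R))

/-- The integral operator whose fixed point solves the Hamilton–Jacobi hierarchy. -/
def picard (f : Big n (PowerSeries R)) : Big n (PowerSeries R) :=
  f₀ + coeffMap (coeffMap J : PowerSeries R →+ PowerSeries R) (hjRhs f)

lemma coeff_coeff_picard (f : Big n (PowerSeries R)) (m : ℕ × Fin n →₀ ℕ) (j : ℕ) :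
    PowerSeries.coeff j (coeff m (picard J f₀ f)) =
      PowerSeries.coeff j (coeff m f₀) + J (PowerSeries.coeff j (coeff m (hjRhs f))) := by
  rw [picard, map_add, map_add]; rfl

variable {f₀} in
lemma vanishesOnAxis_picard (hn : 2 ≤ n) (h₀ : VanishesOnAxis f₀) {f : Big n (PowerSeries R)}
    (h : VanishesOnAxis f) : VanishesOnAxis (picard J f₀ f) := fun m hm => by
  rw [picard, map_add, h₀ m hm, zero_add, coeff_coeffMap, vanishesOnAxis_hjRhs hn h m hm, map_zero]

lemma AgreeBelow.picard (hn : 2 ≤ n) {k : ℕ} {f g : Big n (PowerSeries R)}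
    (h : AgreeBelow k f g) (hf : VanishesOnAxis f) (hg : VanishesOnAxis g) :
    AgreeBelow (k + 1) (picard J f₀ f) (picard J f₀ g) := fun m j hj => by
  rw [coeff_coeff_picard, coeff_coeff_picard, h.hjRhs hn hf hg m j hj]

variable {f₀} in
lemma exists_picard_eq (hn : 2 ≤ n) (h₀ : VanishesOnAxis f₀) :
    ∃ f, VanishesOnAxis f ∧ picard J f₀ f = f := by
  set u : ℕ → Big n (PowerSeries R) := fun k => (picard J f₀)^[k] 0 with hu
  have hu1 (k : ℕ) : u (k + 1) = picard J f₀ (u k) := Function.iterate_succ_apply' _ _ _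
  have hv (k : ℕ) : VanishesOnAxis (u k) := by
    induction k with
    | zero => intro m _; simp [hu]
    | succ k ih => rw [hu1]; exact vanishesOnAxis_picard J hn h₀ ih
  have hstep (k : ℕ) : AgreeBelow k (u k) (u (k + 1)) := by
    induction k with
    | zero => intro m j hj; omega
    | succ k ih => rw [hu1 k, hu1 (k + 1)]; exact ih.picard J f₀ hn (hv k) (hv (k + 1))
  have hle (k l : ℕ) (hkl : k ≤ l) : AgreeBelow k (u k) (u l) := by
    induction l, hkl using Nat.le_induction with
    | base => intro m j _; rfl
    | succ l hl ih => exact ih.trans ((hstep l).mono hl)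
  -- A coefficient of weight `wt m` at `ħ^j` is stable from the iterate `wt m + j + 1` onwards, so
  -- the limit is read off there.
  let f : Big n (PowerSeries R) := fun m => PowerSeries.mk fun j =>
    PowerSeries.coeff j (coeff m (u (wt m + j + 1)))
  have hf (k : ℕ) : AgreeBelow k f (u k) := fun m j hj => by
    have h1 : PowerSeries.coeff j (coeff m f) =
        PowerSeries.coeff j (coeff m (u (wt m + j + 1))) :=
      PowerSeries.coeff_mk j fun j => PowerSeries.coeff j (coeff m (u (wt m + j + 1)))
    rw [h1]
    exact hle _ _ hj m j (Nat.lt_succ_self _)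
  have hfv : VanishesOnAxis f := fun m hm => by
    ext j
    rw [hf (wt m + j + 1) m j (Nat.lt_succ_self _), hv _ m hm]
  refine ⟨f, hfv, ?_⟩
  ext m j
  have h1 := (hf (wt m + j)).picard J f₀ hn hfv (hv _) m j (Nat.lt_succ_self _)
  rw [h1, ← hu1, hf (wt m + j + 1) m j (Nat.lt_succ_self _)]

end Picard

/-! ### Solutions with coefficients polynomial in the deformation parameter. -/

section HamiltonJacobi

open Polynomial in
/-- Integration of polynomials from zero. -/
def polyInt : ℂ[X] →ₗ[ℂ] ℂ[X] :=
  Polynomial.lsum fun k => (Polynomial.monomial (k + 1)).comp (LinearMap.mulLeft ℂ ((k + 1 : ℂ)⁻¹))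

lemma derivative_polyInt (p : Polynomial ℂ) : Polynomial.derivative (polyInt p) = p := by
  suffices h : Polynomial.derivative ∘ₗ polyInt = LinearMap.id from LinearMap.congr_fun h p
  refine Polynomial.lhom_ext' fun k => LinearMap.ext fun c => ?_
  have : (k : ℂ) + 1 ≠ 0 := by exact_mod_cast k.succ_ne_zero
  simp [polyInt, Polynomial.lsum_apply]
  field_simp

lemma eval_zero_polyInt (p : Polynomial ℂ) : (polyInt p).eval 0 = 0 := by
  suffices h : Polynomial.leval 0 ∘ₗ polyInt = 0 from LinearMap.congr_fun h p
  refine Polynomial.lhom_ext' fun k => LinearMap.ext fun c => ?_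
  simp [polyInt, Polynomial.lsum_apply, Polynomial.leval]

/-- The derivation `∂/∂s` on polynomials in the deformation parameter `s`. -/
def derS : Derivation ℂ (Polynomial ℂ) (Polynomial ℂ) := Polynomial.derivative'

/-- Evaluation of the deformation parameter `s`. -/
def evalS (c : ℂ) : Polynomial ℂ →ₐ[ℂ] ℂ := Polynomial.aeval c

/-- The Picard operator integrates in `s` from zero. Running it over `ℂ[s]` ensures that every
coefficient is a polynomial, so that evaluation at `s = 1` raises no question of convergence. -/
lemma exists_hamiltonJacobi {n : ℕ} [NeZero n] (hn : 2 ≤ n) {F₀ : Big n ℂ}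
    (h₀ : VanishesOnAxis F₀) :
    ∃ f : Big n (PowerSeries (Polynomial ℂ)), VanishesOnAxis f ∧
      (∀ m j, Polynomial.derivative (PowerSeries.coeff j (coeff m f)) =
        PowerSeries.coeff j (coeff m (hjRhs f))) ∧
      ∀ m j, (PowerSeries.coeff j (coeff m f)).eval 0 = if j = 0 then coeff m F₀ else 0 := by
  obtain ⟨f, hf, hfix⟩ := exists_picard_eq (n := n) (polyInt : Polynomial ℂ →+ Polynomial ℂ)
    (f₀ := MvPowerSeries.map (PowerSeries.C.comp Polynomial.C) F₀) hn
    (fun m hm => by rw [coeff_map, h₀ m hm, map_zero])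
  have hc (m : ℕ × Fin n →₀ ℕ) (j : ℕ) : PowerSeries.coeff j (coeff m f) =
      (if j = 0 then Polynomial.C (coeff m F₀) else 0) +
        polyInt (PowerSeries.coeff j (coeff m (hjRhs f))) := by
    conv_lhs => rw [← hfix]
    rw [coeff_coeff_picard, coeff_map, RingHom.comp_apply, PowerSeries.coeff_C]
    rfl
  refine ⟨f, hf, fun m j => ?_, fun m j => ?_⟩
  · rw [hc, map_add, derivative_polyInt]
    split_ifs <;> simp
  · rw [hc, Polynomial.eval_add, eval_zero_polyInt]
    split_ifs <;> simp

end HamiltonJacobi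

end InversionHierarchy
end

noncomputable section

namespace InversionHierarchy

open MvPowerSeries Finsupp

/-! ### Functoriality of Laurent series in their coefficients. -/

section LaurentOperations

variable {R S : Type} [CommRing R] [CommRing S]

/-- The coefficient of `ħ^j`. -/
def laurCoeff (j : ℤ) : Laur R →+ R where
  toFun x := HahnSeries.coeff (Γ := ℤ) x j
  map_zero' := rfl
  map_add' _ _ := rfl

lemma laur_ext {x y : Laur R} (h : ∀ j, laurCoeff j x = laurCoeff j y) : x = y :=
  HahnSeries.ext (funext h)

/-- An additive map of coefficients, applied to Laurent series. -/
def laurMap (ψ : R →+ S) : Laur R →+ Laur S where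
  toFun x := HahnSeries.map (Γ := ℤ) x ψ
  map_zero' := laur_ext fun _ => map_zero ψ
  map_add' _ _ := laur_ext fun _ => map_add ψ _ _

lemma laurCoeff_laurMap (ψ : R →+ S) (x : Laur R) (j : ℤ) :
    laurCoeff j (laurMap ψ x) = ψ (laurCoeff j x) := rfl

/-- The monomial `c ħ^j`. -/
def laurSingle (j : ℤ) (c : R) : Laur R := HahnSeries.single (Γ := ℤ) j c

lemma laurCoeff_single_mul (i j : ℤ) (x : Laur R) :
    laurCoeff j (laurSingle i 1 * x) = laurCoeff (j - i) x :=
  HahnSeries.coeff_single_mul.trans (one_mul _)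

/-- Power series as Laurent series. -/
def laurOfPowerSeries : PowerSeries R →+* Laur R := HahnSeries.ofPowerSeries ℤ R

lemma laurCoeff_ofPowerSeries (p : PowerSeries R) (j : ℕ) :
    laurCoeff j (laurOfPowerSeries p) = PowerSeries.coeff j p :=
  HahnSeries.ofPowerSeries_apply_coeff p j

lemma laurCoeff_ofPowerSeries_neg (p : PowerSeries R) {j : ℤ} (hj : j < 0) :
    laurCoeff j (laurOfPowerSeries p) = 0 := by
  refine HahnSeries.embDomain_of_notMem_range ?_
  rintro ⟨k, hk⟩
  have : (k : ℤ) = j := hk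
  omega

lemma laurCoeff_ofPowerSeries_congr {ψ : R →+ S} {p : PowerSeries R} {q : PowerSeries S}
    (h : ∀ j, PowerSeries.coeff j q = ψ (PowerSeries.coeff j p)) :
    laurOfPowerSeries q = laurMap ψ (laurOfPowerSeries p) := by
  refine laur_ext fun j => ?_
  rw [laurCoeff_laurMap]
  rcases lt_or_ge j 0 with hj | hj
  · rw [laurCoeff_ofPowerSeries_neg _ hj, laurCoeff_ofPowerSeries_neg _ hj, map_zero]
  · lift j to ℕ using hj
    rw [laurCoeff_ofPowerSeries, laurCoeff_ofPowerSeries, h]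

lemma laurOfPowerSeries_X : laurOfPowerSeries (PowerSeries.X : PowerSeries R) = laurSingle 1 1 :=
  HahnSeries.ofPowerSeries_X

lemma laurSingle_mul (i j : ℤ) (a b : R) :
    laurSingle i a * laurSingle j b = laurSingle (i + j) (a * b) :=
  HahnSeries.single_mul_single

lemma laurSingle_zero_one : laurSingle 0 (1 : R) = 1 := rfl

lemma laurMap_single_mul (ψ : R →+ S) (i : ℤ) (x : Laur R) :
    laurMap ψ (laurSingle i 1 * x) = laurSingle i 1 * laurMap ψ x :=
  laur_ext fun j => by
    rw [laurCoeff_laurMap, laurCoeff_single_mul, laurCoeff_single_mul, laurCoeff_laurMap]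

variable [Algebra ℂ R] [Algebra ℂ S]

lemma laurMap_smul (ψ : R →ₗ[ℂ] S) (c : ℂ) (x : Laur R) :
    laurMap (ψ : R →+ S) (c • x) = c • laurMap (ψ : R →+ S) x :=
  laur_ext fun _ => map_smul ψ _ _

lemma laurOfPowerSeries_smul (c : ℂ) (p : PowerSeries R) :
    laurOfPowerSeries (c • p) = c • laurOfPowerSeries p :=
  laurCoeff_ofPowerSeries_congr (ψ := DistribSMul.toAddMonoidHom R c) fun _ => rfl

/-- A homomorphism of coefficient algebras, applied to Laurent series. -/
def laurAlgHom (ψ : R →ₐ[ℂ] S) : Laur R →ₐ[ℂ] Laur S :=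
  AlgHom.ofLinearMap
    { toFun := laurMap (ψ : R →+ S)
      map_add' := map_add _
      map_smul' := fun c x => laur_ext fun _ => map_smul ψ _ _ }
    (laur_ext fun j => by
      change ψ (HahnSeries.coeff (1 : HahnSeries ℤ R) j) = HahnSeries.coeff (1 : HahnSeries ℤ S) j
      rw [HahnSeries.coeff_one, HahnSeries.coeff_one]
      split_ifs <;> simp)
    fun x y => HahnSeries.map_mul (Γ := ℤ) (ψ : R →ₙ+* S)

/-- Differentiating coefficients can only shrink supports, so both product sums may be taken over
the pairs from the original supports and compared term by term. -/
lemma hahnSeries_map_mul_der (d : Derivation ℂ R R) (x y : HahnSeries ℤ R) :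
    (x * y).map (d : R →+ R) = x * y.map (d : R →+ R) + y * x.map (d : R →+ R) := by
  have hs (z : HahnSeries ℤ R) : (z.map (d : R →+ R)).support ⊆ z.support :=
    fun a ha h => ha (by rw [HahnSeries.map_coeff, h, map_zero])
  ext a
  rw [HahnSeries.coeff_add, mul_comm y, HahnSeries.map_coeff, HahnSeries.coeff_mul,
    HahnSeries.coeff_mul_right' y.isPWO_support (hs y),
    HahnSeries.coeff_mul_left' x.isPWO_support (hs x), map_sum, ← Finset.sum_add_distrib]
  refine Finset.sum_congr rfl fun z _ => ?_
  rw [mul_comm (HahnSeries.coeff (x.map (d : R →+ R)) z.1)]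
  exact d.leibniz _ _

/-- A derivation of the coefficients, applied to Laurent series. -/
def laurDer (d : Derivation ℂ R R) : Derivation ℂ (Laur R) (Laur R) :=
  Derivation.mk'
    { toFun := laurMap (d : R →+ R)
      map_add' := map_add _
      map_smul' := fun _ _ => laur_ext fun _ => d.map_smul _ _ }
    fun x y => hahnSeries_map_mul_der d x y

end LaurentOperations

/-! ### From the genus expansion to Laurent exponents. -/

section GenusExpansion

variable {n : ℕ} [NeZero n] {R S : Type} [CommRing R] [Algebra ℂ R] [CommRing S] [Algebra ℂ S]

/-- The series `∑_g ħ^{g-1} F_g`, for `f = ∑_g ħ^g F_g`. -/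
def genusLaur (f : Big n (PowerSeries R)) : Big n (Laur R) :=
  C (laurSingle (-1) 1) * MvPowerSeries.map laurOfPowerSeries f

omit [NeZero n] [Algebra ℂ R] in
lemma coeff_genusLaur (f : Big n (PowerSeries R)) (m : ℕ × Fin n →₀ ℕ) :
    coeff m (genusLaur f) = laurSingle (-1) 1 * laurOfPowerSeries (coeff m f) := by
  rw [genusLaur, coeff_C_mul, coeff_map]

omit [Algebra ℂ R] in
omit [NeZero n] in
lemma constantCoeff_genusLaur_of_coeff {f : Big n (PowerSeries R)} (hf : coeff 0 f = 0) :
    constantCoeff (genusLaur f) = 0 := by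
  rw [← coeff_zero_eq_constantCoeff_apply, coeff_genusLaur, hf, map_zero, mul_zero]

omit [Algebra ℂ R] in
lemma constantCoeff_genusLaur {f : Big n (PowerSeries R)} (hf : VanishesOnAxis f) :
    constantCoeff (genusLaur f) = 0 :=
  constantCoeff_genusLaur_of_coeff (hf 0 (map_zero _))

lemma coeffMap_heatOp (ψ : R →+ S) {h : R} {h' : S}
    (hψ : ∀ r, ψ (((1 / 2 : ℂ) • h) * r) = ((1 / 2 : ℂ) • h') * ψ r) (f : Big n R) :
    coeffMap ψ (heatOp h f) = heatOp h' (coeffMap ψ f) := by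
  rw [heatOp, heatOp, map_sub, coeffMap_shiftOp]
  simp only [dt]
  rw [← coeffMap_pderiv, ← coeffMap_pderiv]
  congr 1
  ext m
  rw [coeff_coeffMap, coeff_C_mul, hψ, coeff_C_mul, coeff_coeffMap]

/-- In the exponent the quadratic term carries `ħ · ħ^{-2} = ħ^{-1}`, which is exactly the global
prefactor; this is why it appears without `ħ` in `hjRhs`. -/
lemma genusLaur_hjRhs (f : Big n (PowerSeries R)) :
    genusLaur (hjRhs f) = shiftOp (genusLaur f) - C ((1 / 2 : ℂ) • laurSingle 1 1) *
      (dt 0 0 (dt 0 0 (genusLaur f)) + dt 0 0 (genusLaur f) * dt 0 0 (genusLaur f)) := by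
  have hC (c : Laur R) (g : Big n (Laur R)) (x : ℕ × Fin n) :
      pderiv (Laur R) x (C c * g) = C c * pderiv (Laur R) x g := by
    rw [← smul_eq_C_mul, Derivation.map_smul, smul_eq_C_mul]
  have hS (c : Laur R) (g : Big n (Laur R)) : shiftOp (C c * g) = C c * shiftOp g := by
    rw [← smul_eq_C_mul, Derivation.map_smul, smul_eq_C_mul]
  have hsm (c : ℂ) (g : Big n (PowerSeries R)) :
      MvPowerSeries.map laurOfPowerSeries (c • g) =
        C (c • 1) * MvPowerSeries.map laurOfPowerSeries g := by
    ext m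
    rw [coeff_map, coeff_smul_complex, laurOfPowerSeries_smul, coeff_C_mul, coeff_map, smul_one_mul]
  have hX : (laurOfPowerSeries ((1 / 2 : ℂ) • (PowerSeries.X : PowerSeries R))) =
      (1 / 2 : ℂ) • laurSingle 1 1 := by
    rw [laurOfPowerSeries_smul, laurOfPowerSeries_X]
  have h1 : laurSingle (-1) 1 * laurSingle 1 (1 : R) = 1 := by
    rw [laurSingle_mul]; simp [laurSingle_zero_one]
  simp only [genusLaur, hjRhs, heatOp, dt, map_sub, map_mul, hsm, hC, hS, map_shiftOp, map_pderiv,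
    map_C, hX]
  have h2 : (1 / 2 : ℂ) • laurSingle 1 (1 : R) = (1 / 2 : ℂ) • 1 * laurSingle 1 (1 : R) := by
    rw [smul_one_mul]
  have h3 : C (laurSingle (-1) 1) * C (laurSingle 1 (1 : R)) = (1 : Big n (Laur R)) := by
    rw [← map_mul, h1, map_one]
  rw [h2, map_mul]
  generalize MvPowerSeries.map laurOfPowerSeries f = g at *
  generalize pderiv (Laur R) (0, 0) g = p at *
  linear_combination (C (laurSingle (-1) 1) * C ((1 / 2 : ℂ) • 1) * p * p) * h3

end GenusExpansion

/-! ### The exponential action and the uniqueness of its logarithm. -/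

section ExpAction

variable {n : ℕ} [NeZero n]

/-- The coefficient of `s^k`. -/
def coeffS (k : ℕ) : Polynomial ℂ →ₗ[ℂ] ℂ := Polynomial.lcoeff ℂ k

lemma hbar_eq : hbar = laurSingle 1 (1 : ℂ) := rfl

lemma heatOp_smul {R : Type} [CommRing R] [Algebra ℂ R] (h : R) (c : ℂ) (f : Big n R) :
    heatOp h (c • f) = c • heatOp h f := by
  have hc (g : Big n R) : c • g = C (algebraMap ℂ R c) * g := by
    ext m; rw [coeff_smul_complex, coeff_C_mul, Algebra.smul_def]
  simp only [heatOp, dt, hc]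
  simp only [← smul_eq_C_mul, Derivation.map_smul]
  simp only [smul_eq_C_mul]
  ring

lemma exp_laurent_heat {f : Big n (PowerSeries (Polynomial ℂ))} (hf : VanishesOnAxis f)
    (hhj : ∀ m j, Polynomial.derivative (PowerSeries.coeff j (coeff m f)) =
        PowerSeries.coeff j (coeff m (hjRhs f))) :
    coeffDer (laurDer derS) (expo (genusLaur f)) =
      heatOp (laurSingle 1 1) (expo (genusLaur f)) := by
  have h0 := constantCoeff_genusLaur hf
  rw [der_expo _ (degreeLocal_coeffDer _) h0, heatOp_expo _ h0, ← genusLaur_hjRhs]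
  congr 1
  ext m
  rw [coeffDer_apply, coeff_coeffMap, coeff_genusLaur, coeff_genusLaur]
  refine (laurMap_single_mul (derS : Polynomial ℂ →+ Polynomial ℂ) _ _).trans ?_
  congr 1
  exact (laurCoeff_ofPowerSeries_congr fun j => (hhj m j).symm).symm

/-- Comparing powers of `s` in the heat equation for `exp(ħ^{-1} Ψ_s)` identifies its Taylor
coefficients with the terms of the operator exponential. -/
lemma coeffMap_coeffS_expo {f : Big n (PowerSeries (Polynomial ℂ))} (hf : VanishesOnAxis f)
    (hhj : ∀ m j, Polynomial.derivative (PowerSeries.coeff j (coeff m f)) =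
        PowerSeries.coeff j (coeff m (hjRhs f))) (k : ℕ) :
    coeffMap (laurMap (coeffS k : Polynomial ℂ →+ ℂ)) (expo (genusLaur f)) =
      ((k ! : ℂ)⁻¹) • (heatOp (laurSingle 1 1))^[k]
        (coeffMap (laurMap (coeffS 0 : Polynomial ℂ →+ ℂ)) (expo (genusLaur f))) := by
  set E := expo (genusLaur f) with hE
  induction k with
  | zero => simp
  | succ k ih =>
    have h1 : ((k : ℂ) + 1) • coeffMap (laurMap (coeffS (k + 1) : Polynomial ℂ →+ ℂ)) E =
        coeffMap (laurMap (coeffS k : Polynomial ℂ →+ ℂ)) (coeffDer (laurDer derS) E) := by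
      ext m
      refine laur_ext fun j => ?_
      have : ∀ p : Polynomial ℂ, coeffS k (Polynomial.derivative p) =
          ((k : ℂ) + 1) * coeffS (k + 1) p := fun p => by
        simp [coeffS, Polynomial.coeff_derivative, mul_comm]
      exact (this _).symm
    rw [exp_laurent_heat hf hhj, coeffMap_heatOp (h' := laurSingle 1 1), ih, heatOp_smul,
      ← Function.iterate_succ_apply' (heatOp (laurSingle 1 1))] at h1
    · have hk : (k : ℂ) + 1 ≠ 0 := by exact_mod_cast k.succ_ne_zero
      rw [(eq_inv_smul_iff₀ hk).mpr h1, smul_smul, Nat.factorial_succ, Nat.cast_mul,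
        mul_inv, Nat.cast_succ]
    · intro r
      rw [smul_mul_assoc, laurMap_smul, laurMap_single_mul, smul_mul_assoc]

omit [NeZero n] in
lemma overHbar_eq (F₀ : Big n ℂ) :
    overHbar F₀ = genusLaur (MvPowerSeries.map PowerSeries.C F₀) := by
  ext1 m
  refine Eq.trans ?_ (coeff_genusLaur _ m).symm
  have h : laurOfPowerSeries (PowerSeries.C (coeff m F₀)) = laurSingle 0 (coeff m F₀) :=
    HahnSeries.ofPowerSeries_C _
  rw [coeff_map, h, laurSingle_mul, one_mul]
  rfl

lemma constantCoeff_overHbar {F₀ : Big n ℂ} (h : VanishesOnAxis F₀) :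
    constantCoeff (R := Laur ℂ) (overHbar F₀) = 0 := by
  have h' : VanishesOnAxis (MvPowerSeries.map PowerSeries.C F₀) := fun m hm => by
    rw [coeff_map, h m hm, map_zero]
  rw [overHbar_eq]
  exact constantCoeff_genusLaur h'

/-- The series `∑_g ħ^g F_g`. -/
def collect {R : Type} [CommRing R] (f : ℕ → Big n R) : Big n (PowerSeries R) :=
  fun m => PowerSeries.mk fun g => coeff m (f g)

omit [NeZero n] in
lemma coeff_collect {R : Type} [CommRing R] (f : ℕ → Big n R) (m : ℕ × Fin n →₀ ℕ) (g : ℕ) :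
    PowerSeries.coeff g (coeff m (collect f)) = coeff m (f g) :=
  PowerSeries.coeff_mk g fun g => coeff m (f g)

omit [NeZero n] in
lemma genusSeries_eq (f : ℕ → Big n ℂ) : genusSeries f = genusLaur (collect f) := by
  ext1 m
  exact (coeff_genusLaur (collect f) m).symm

omit [NeZero n] in
lemma constantCoeff_genusSeries {f : ℕ → Big n ℂ} (h : ∀ g, constantCoeff (f g) = 0) :
    constantCoeff (R := Laur ℂ) (genusSeries f) = 0 := by
  have h0 : coeff (0 : ℕ × Fin n →₀ ℕ) (collect f) = 0 := by
    ext g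
    rw [coeff_collect, coeff_zero_eq_constantCoeff_apply, h, map_zero]
  rw [genusSeries_eq]
  exact constantCoeff_genusLaur_of_coeff h0

omit [NeZero n] in
lemma genusSeries_injective {f g : ℕ → Big n ℂ} (h : genusSeries f = genusSeries g) : f = g := by
  funext k
  ext m
  rw [genusSeries_eq, genusSeries_eq] at h
  have h1 (f : ℕ → Big n ℂ) :
      laurCoeff ((k : ℤ) - 1) (coeff m (genusLaur (collect f))) = coeff m (f k) := by
    rw [coeff_genusLaur, laurCoeff_single_mul, sub_neg_eq_add, sub_add_cancel,
      laurCoeff_ofPowerSeries, coeff_collect]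
  rw [← h1, ← h1, h]

/-- The value at `s = 1` of the coefficient of `ħ^g`. -/
def genusAtOne (f : Big n (PowerSeries (Polynomial ℂ))) (g : ℕ) : Big n ℂ :=
  fun m => evalS 1 (PowerSeries.coeff g (coeff m f))

instance (R : Type) [CommRing R] [IsAddTorsionFree R] : IsAddTorsionFree (Laur R) where
  nsmul_right_injective k hk x y h := laur_ext fun j => by
    have := congrArg (laurCoeff j) h
    simp only [map_nsmul] at this
    exact nsmul_right_injective hk this

lemma isExpAction_genusAtOne (hn : 2 ≤ n) {F₀ : Big n ℂ}
    {f : Big n (PowerSeries (Polynomial ℂ))} (hf : VanishesOnAxis f)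
    (hhj : ∀ m j, Polynomial.derivative (PowerSeries.coeff j (coeff m f)) =
        PowerSeries.coeff j (coeff m (hjRhs f)))
    (h₀ : ∀ m j, (PowerSeries.coeff j (coeff m f)).eval 0 = if j = 0 then coeff m F₀ else 0) :
    IsExpAction (quantized 1 (rOne n)) (expS (overHbar F₀)) (expS (genusSeries (genusAtOne f))) := by
  have hc := constantCoeff_genusLaur hf
  have hmap (c : ℂ) (m : ℕ × Fin n →₀ ℕ) (q : PowerSeries ℂ)
      (hq : ∀ j, PowerSeries.coeff j q = evalS c (PowerSeries.coeff j (coeff m f))) :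
      laurSingle (-1) 1 * laurOfPowerSeries q =
        coeff m (MvPowerSeries.map (laurAlgHom (evalS c) : Laur (Polynomial ℂ) →+* Laur ℂ)
          (genusLaur f)) := by
    rw [coeff_map, coeff_genusLaur]
    refine Eq.trans ?_ (laurMap_single_mul (evalS c : Polynomial ℂ →+ ℂ) _ _).symm
    rw [laurCoeff_ofPowerSeries_congr (ψ := (evalS c : Polynomial ℂ →+ ℂ)) hq]
  have h1 : genusSeries (genusAtOne f) =
      MvPowerSeries.map (laurAlgHom (evalS 1) : Laur (Polynomial ℂ) →+* Laur ℂ) (genusLaur f) := by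
    rw [genusSeries_eq]
    ext1 m
    rw [coeff_genusLaur]
    exact hmap 1 m _ fun j => coeff_collect _ m j
  have h2 : overHbar F₀ =
      MvPowerSeries.map (laurAlgHom (evalS 0) : Laur (Polynomial ℂ) →+* Laur ℂ) (genusLaur f) := by
    rw [overHbar_eq]
    ext1 m
    rw [coeff_genusLaur]
    refine hmap 0 m _ fun j => ?_
    rw [coeff_map, PowerSeries.coeff_C, evalS, Polynomial.coe_aeval_eq_eval, h₀]
  have h3 : coeffMap (laurMap (coeffS 0 : Polynomial ℂ →+ ℂ)) (expo (genusLaur f)) =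
      expo (R := Laur ℂ) (overHbar F₀) := by
    rw [h2, ← map_expo _ hc]
    ext m
    refine laur_ext fun j => ?_
    change coeffS 0 _ = evalS 0 _
    rw [evalS, Polynomial.coe_aeval_eq_eval, ← Polynomial.coeff_zero_eq_eval_zero]
    rfl
  rw [quantized_rOne hn, expS_eq, expS_eq]
  intro m j
  set p : Polynomial ℂ := laurCoeff j (coeff m (expo (genusLaur f))) with hp
  have h4 (k : ℕ) : ((k ! : ℂ))⁻¹ * laurCoeff j (coeff m
      ((heatOp (R := Laur ℂ) hbar)^[k] (expo (R := Laur ℂ) (overHbar F₀)))) = p.coeff k := by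
    have := congrArg (fun g => laurCoeff j (coeff m g)) (coeffMap_coeffS_expo hf hhj k)
    rw [h3] at this
    exact this.symm
  have h5 : laurCoeff j (coeff m (expo (R := Laur ℂ) (genusSeries (genusAtOne f)))) =
      p.eval 1 := by
    rw [h1, ← map_expo _ hc]
    change evalS 1 p = _
    rw [evalS, Polynomial.coe_aeval_eq_eval]
  change HasSum (fun k : ℕ => ((k ! : ℂ))⁻¹ * laurCoeff j (coeff m
      ((heatOp (R := Laur ℂ) hbar)^[k] (expo (R := Laur ℂ) (overHbar F₀)))))
    (laurCoeff j (coeff m (expo (R := Laur ℂ) (genusSeries (genusAtOne f)))))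
  simp only [h4, h5]
  have h6 := Polynomial.eval_eq_sum_range (p := p) 1
  simp only [one_pow, mul_one] at h6
  rw [h6]
  -- The terms are the coefficients of the polynomial `p`, so the sum is finite and equals `p(1)`.
  refine hasSum_sum_of_ne_finset_zero fun k hk => Polynomial.coeff_eq_zero_of_natDegree_lt ?_
  simpa [Nat.lt_succ_iff] using hk

/-- Sums in `ℂ` are unique, so any admissible genus expansion has the same exponential as the
constructed one. Without constant terms the exponents agree, and the powers of `ħ` separate the
genera. -/
lemma isRTransform_iff (hn : 2 ≤ n) {F₀ : Big n ℂ}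
    {f : Big n (PowerSeries (Polynomial ℂ))} (hf : VanishesOnAxis f)
    (hhj : ∀ m j, Polynomial.derivative (PowerSeries.coeff j (coeff m f)) =
        PowerSeries.coeff j (coeff m (hjRhs f)))
    (h₀ : ∀ m j, (PowerSeries.coeff j (coeff m f)).eval 0 = if j = 0 then coeff m F₀ else 0)
    (G : Big n ℂ) : IsRTransform F₀ G ↔ G = genusAtOne f 0 := by
  have hcc (g : ℕ) : constantCoeff (genusAtOne f g) = 0 := by
    rw [← coeff_zero_eq_constantCoeff_apply]
    change evalS 1 (PowerSeries.coeff g (coeff 0 f)) = 0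
    rw [hf 0 (map_zero _), map_zero, map_zero]
  have hexp := isExpAction_genusAtOne hn hf hhj h₀
  constructor
  · rintro ⟨f', rfl, hc, h⟩
    have h1 : expS (genusSeries f') = expS (genusSeries (genusAtOne f)) := by
      ext m : 1
      exact HahnSeries.ext (funext fun j => (h m j).unique (hexp m j))
    rw [expS_eq, expS_eq] at h1
    rw [genusSeries_injective (expo_injective (R := Laur ℂ) (constantCoeff_genusSeries hc)
      (constantCoeff_genusSeries hcc) h1)]
  · rintro rfl
    exact ⟨genusAtOne f, rfl, hcc, hexp⟩

lemma map_constantCoeff_hjRhs {R : Type} [CommRing R] [Algebra ℂ R] (f : Big n (PowerSeries R)) :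
    MvPowerSeries.map PowerSeries.constantCoeff (hjRhs f) =
      shiftOp (MvPowerSeries.map PowerSeries.constantCoeff f) -
        (1 / 2 : ℂ) • (dt 0 0 (MvPowerSeries.map PowerSeries.constantCoeff f) *
          dt 0 0 (MvPowerSeries.map PowerSeries.constantCoeff f)) := by
  have hsm (c : ℂ) (p : PowerSeries R) :
      PowerSeries.constantCoeff (c • p) = c • PowerSeries.constantCoeff p := rfl
  have hsm' (c : ℂ) (g : Big n (PowerSeries R)) :
      MvPowerSeries.map PowerSeries.constantCoeff (c • g) =
        c • MvPowerSeries.map PowerSeries.constantCoeff g := rfl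
  simp only [hjRhs, heatOp, map_sub, map_mul, map_C, dt, map_pderiv, map_shiftOp, hsm, hsm',
    PowerSeries.constantCoeff_X, smul_zero, map_zero, zero_mul, sub_zero]

/-- The infinitesimal deformation of the genus zero potential is the right hand side of the
Hamilton–Jacobi equation. -/
lemma infDeform_eq (hn : 2 ≤ n) {F₀ : Big n ℂ} (h₀ : VanishesOnAxis F₀) :
    infDeform F₀ = shiftOp F₀ - (1 / 2 : ℂ) • (dt 0 0 F₀ * dt 0 0 F₀) := by
  have hc := constantCoeff_overHbar h₀
  have h1 : (expS (-overHbar F₀) * quantized 1 (rOne n) (expS (overHbar F₀)) : Big n (Laur ℂ)) =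
      genusLaur (hjRhs (MvPowerSeries.map PowerSeries.C F₀)) := by
    rw [quantized_rOne hn, expS_eq, expS_eq, hbar_eq]
    refine (congrArg (expo (R := Laur ℂ) (-overHbar F₀) * ·)
      (heatOp_expo (R := Laur ℂ) (laurSingle 1 1) hc)).trans ?_
    rw [genusLaur_hjRhs, ← overHbar_eq]
    have h2 := expo_neg_mul_expo (R := Laur ℂ) hc
    refine (mul_left_comm _ _ _).trans ?_
    exact (congrArg _ h2).trans (mul_one _)
  ext m
  have h3 : coeff m (infDeform F₀) = laurCoeff (-1) (coeff m
      (expS (-overHbar F₀) * quantized 1 (rOne n) (expS (overHbar F₀)) : Big n (Laur ℂ))) := rfl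
  rw [h3, h1, coeff_genusLaur, laurCoeff_single_mul, sub_self]
  refine (laurCoeff_ofPowerSeries _ 0).trans ?_
  have h4 (g : Big n (PowerSeries ℂ)) : PowerSeries.coeff 0 (coeff m g) =
      coeff m (MvPowerSeries.map PowerSeries.constantCoeff g) := by
    rw [coeff_map, PowerSeries.coeff_zero_eq_constantCoeff_apply]
  rw [h4]
  have h5 : MvPowerSeries.map PowerSeries.constantCoeff
      (MvPowerSeries.map PowerSeries.C F₀) = F₀ := by
    ext m; simp
  rw [map_constantCoeff_hjRhs, h5]

end ExpAction

end InversionHierarchy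
end

noncomputable section

namespace InversionHierarchy

open MvPowerSeries
open Finsupp hiding some

/-! ### Restriction to the small phase space and `t^{1,1}`. -/

section Restriction

variable {n : ℕ} [NeZero n] {R : Type} [CommRing R]

omit [NeZero n] in
/-- The variables of the small phase space. -/
def smallEmb : Fin n ↪ ℕ × Fin n := ⟨fun μ => (0, μ), fun _ _ h => (Prod.mk.inj h).2⟩

/-- The variables of the small phase space, together with `t^{1,1}`. -/
def dilatonEmb : Option (Fin n) ↪ ℕ × Fin n where
  toFun x := x.elim (1, 0) fun μ => (0, μ)
  inj' x y h := by
    rcases x with _ | x <;> rcases y with _ | y <;> simp_all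

/-- Restriction to the small phase space, over any coefficient ring. -/
def smallHom : Big n R →ₐ[R] MvPowerSeries (Fin n) R := killCompl smallEmb

/-- Restriction to the small phase space extended by the variable `t^{1,1}`. -/
def dilatonHom : Big n R →ₐ[R] MvPowerSeries (Option (Fin n)) R := killCompl dilatonEmb

/-- Restriction to `t^{1,1} = 0`. -/
def dropHom : MvPowerSeries (Option (Fin n)) R →ₐ[R] MvPowerSeries (Fin n) R :=
  killCompl Function.Embedding.some

omit [NeZero n] in
lemma small_eq (f : Big n ℂ) : small f = smallHom f := by
  ext m
  rw [smallHom, coeff_killCompl, embDomain_eq_mapDomain]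
  rfl

lemma dropHom_dilatonHom (f : Big n R) : dropHom (dilatonHom f) = smallHom f := by
  ext m
  rw [dropHom, dilatonHom, smallHom, coeff_killCompl, coeff_killCompl, coeff_killCompl]
  simp only [embDomain_eq_mapDomain, ← mapDomain_comp]
  rfl

omit [NeZero n] in
lemma smallHom_dt (μ : Fin n) (f : Big n R) :
    smallHom (dt 0 μ f) = pderiv R μ (smallHom f) := killCompl_pderiv smallEmb μ f

lemma dilatonHom_dt (μ : Fin n) (f : Big n R) :
    dilatonHom (dt 0 μ f) = pderiv R (some μ) (dilatonHom f) :=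
  killCompl_pderiv dilatonEmb (some μ) f

lemma dilatonHom_dt_one (f : Big n R) :
    dilatonHom (dt 1 0 f) = pderiv R none (dilatonHom f) :=
  killCompl_pderiv dilatonEmb none f

omit [NeZero n] in
lemma dropHom_pderiv (μ : Fin n) (f : MvPowerSeries (Option (Fin n)) R) :
    dropHom (pderiv R (some μ) f) = pderiv R μ (dropHom f) :=
  killCompl_pderiv Function.Embedding.some μ f

omit [NeZero n] in
lemma dropHom_X (μ : Fin n) : dropHom (X (some μ) : MvPowerSeries (Option (Fin n)) R) = X μ :=
  killCompl_X (e := Function.Embedding.some) μ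

omit [NeZero n] in
lemma dropHom_X_none : dropHom (X none : MvPowerSeries (Option (Fin n)) R) = 0 :=
  killCompl_X_eq_zero (by simp)

/-- The variables `t^{d,n}` with `d ≥ 1` restrict to zero, as `(1,n) ≠ (1,1)`. The surviving term
differentiates along `t^{1,1}`, which is why this variable must be kept. -/
lemma dilatonHom_shiftOp (hn : 2 ≤ n) (f : Big n R) :
    dilatonHom (shiftOp f) = X (some (Fin.rev 0)) * pderiv R none (dilatonHom f) := by
  ext m
  obtain ⟨N, hN, h⟩ := exists_levelBound 1 (embDomain dilatonEmb m)
  rw [dilatonHom, coeff_killCompl, coeff_shiftOp h, ← coeff_killCompl]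
  change coeff m (dilatonHom _) = coeff m (_ * pderiv R none (dilatonHom f))
  congr 1
  rw [shiftPartial_apply, map_sum, Finset.sum_eq_single 0]
  · rw [map_mul]
    exact congrArg₂ _ (killCompl_X (e := dilatonEmb) (some (Fin.rev 0))) (dilatonHom_dt_one f)
  · intro d _ hd
    rw [map_mul]
    refine mul_eq_zero_of_left (killCompl_X_eq_zero ?_) _
    rintro ⟨x, hx⟩
    rcases x with _ | μ
    · exact rev_zero_ne hn (Prod.mk.inj hx).2.symm
    · exact hd (Prod.mk.inj hx).1.symm
  · intro h0; exact absurd (Finset.mem_range.mpr hN) h0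

variable [Algebra ℂ R]

/-- The right hand side of the genus zero Hamilton–Jacobi equation. -/
def hjZero (g : Big n R) : Big n R := shiftOp g - (1 / 2 : ℂ) • (dt 0 0 g * dt 0 0 g)

lemma dt_hjZero (hn : 2 ≤ n) (g : Big n R) :
    dt 0 0 (hjZero g) = shiftOp (dt 0 0 g) - dt 0 0 g * dt 0 0 (dt 0 0 g) := by
  simp only [hjZero, dt]
  rw [map_sub, pderiv_shiftOp, if_neg (Ne.symm (rev_zero_ne hn)), add_zero,
    half_mul_self_der (pderiv R ((0, 0) : ℕ × Fin n)) (map_add _)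
      (fun x y => by rw [Derivation.leibniz]; rfl)]

lemma dilatonHom_dt_hjZero (hn : 2 ≤ n) (g : Big n R) :
    dilatonHom (dt 0 0 (hjZero g)) =
      X (some (Fin.rev 0)) * pderiv R none (dilatonHom (dt 0 0 g)) -
        dilatonHom (dt 0 0 g) * pderiv R (some (0 : Fin n)) (dilatonHom (dt 0 0 g)) := by
  rw [dt_hjZero hn, map_sub, map_mul, dilatonHom_shiftOp hn]
  simp only [dilatonHom_dt]

lemma dilatonHom_dt_dt_hjZero (hn : 2 ≤ n) (α : Fin n) (p : ℕ) (g : Big n R) :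
    dilatonHom (dt p α (dt 0 0 (hjZero g))) =
      X (some (Fin.rev 0)) * pderiv R none (dilatonHom (dt p α (dt 0 0 g))) -
        pderiv R (some (0 : Fin n)) (dilatonHom (dt 0 0 g)) * dilatonHom (dt p α (dt 0 0 g)) -
        dilatonHom (dt 0 0 g) * pderiv R (some (0 : Fin n)) (dilatonHom (dt p α (dt 0 0 g))) +
        if α = Fin.rev 0 then dilatonHom (dt (p + 1) 0 (dt 0 0 g)) else 0 := by
  rw [dt_hjZero hn, ← dilatonHom_dt, ← dilatonHom_dt]
  simp only [dt]
  rw [map_sub, pderiv_shiftOp, Derivation.leibniz,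
    pderiv_comm (0, 0) (p, α) (pderiv R (0, 0) g)]
  simp only [smul_eq_mul, map_sub, map_add, map_mul, dilatonHom_shiftOp hn]
  split_ifs
  · ring
  · rw [map_zero]; ring

end Restriction

/-! ### Uniqueness for formal differential equations. -/

section Uniqueness

variable {ι R : Type} [CommRing R] [IsAddTorsionFree R]

lemma coeff_eq_zero_of_pderiv {σ : Type} {f : MvPowerSeries σ R} {m : σ →₀ ℕ} {i : σ}
    (hi : m i ≠ 0) (h : coeff (m - single i 1) (pderiv R i f) = 0) : coeff m f = 0 := by
  have h1 : single i 1 ≤ m := by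
    rw [single_le_iff]; exact Nat.one_le_iff_ne_zero.mpr hi
  rw [coeff_pderiv, tsub_add_cancel_of_le h1] at h
  rw [mul_natCast_succ] at h
  exact (smul_eq_zero_iff_right (Nat.succ_ne_zero _)).mp h

/-- Induction on the exponent of `t^{1,1}`: the equation expresses each coefficient through
coefficients with a smaller exponent. -/
lemma eq_zero_of_drop_eq_zero [Fintype ι] {r : MvPowerSeries (Option ι) R}
    {c : ι → MvPowerSeries (Option ι) R}
    (h0 : killCompl Function.Embedding.some r = 0)
    (h : pderiv R none r = ∑ μ, c μ * pderiv R (some μ) r) : r = 0 := by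
  classical
  suffices H : ∀ k, ∀ m : Option ι →₀ ℕ, m none = k → coeff m r = 0 by
    ext m; exact H _ m rfl
  intro k
  induction k using Nat.strong_induction_on with
  | _ k ih =>
    intro m hm
    by_cases hk : m none = 0
    · have : m ∈ Set.range (embDomain (M := ℕ) (Function.Embedding.some : ι ↪ Option ι)) := by
        rw [mem_range_embDomain_iff]
        intro x hx
        rcases x with _ | x
        · exact absurd hk (Finsupp.mem_support_iff.mp hx)
        · exact ⟨x, rfl⟩
      obtain ⟨m', rfl⟩ := this
      rw [← coeff_killCompl, h0, map_zero]
    · refine coeff_eq_zero_of_pderiv hk ?_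
      rw [h, map_sum]
      refine Finset.sum_eq_zero fun μ _ => ?_
      rw [coeff_mul]
      refine Finset.sum_eq_zero fun x hx => ?_
      rw [Finset.HasAntidiagonal.mem_antidiagonal] at hx
      have hx' := congrArg (fun y => y none) hx
      simp only [Finsupp.add_apply, Finsupp.tsub_apply, single_eq_same] at hx'
      rw [coeff_pderiv, ih (x.2 none) (by omega), zero_mul, mul_zero]
      simp

lemma eq_zero_of_pderiv_some {r : MvPowerSeries (Option ι) R}
    (h : ∀ μ, pderiv R (some μ) r = 0) (h0 : ∀ k, coeff (single none k) r = 0) : r = 0 := by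
  ext m
  by_cases hm : ∃ μ, m (some μ) ≠ 0
  · obtain ⟨μ, hμ⟩ := hm
    exact coeff_eq_zero_of_pderiv hμ (by rw [h, map_zero])
  · push Not at hm
    have : m = single none (m none) := by
      ext x
      rcases x with _ | x
      · simp
      · simp [hm]
    rw [this, h0, map_zero]

end Uniqueness

/-! ### The quadratic form of the metric. -/

section QuadraticForm

variable {n : ℕ} {A B : Type} [CommRing A] [Algebra ℂ A] [CommRing B] [Algebra ℂ B]

/-- The quadratic form `(1/2) ∑_γ x^γ x^{n+1-γ}`. -/
def quadForm (x : Fin n → A) : A := (1 / 2 : ℂ) • ∑ γ, x γ * x γ.rev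

lemma der_quadForm (δ : Derivation ℂ A A) (x : Fin n → A) :
    δ (quadForm x) = ∑ γ, x γ.rev * δ (x γ) := by
  have h : ∑ γ, x γ * δ (x γ.rev) = ∑ γ, x γ.rev * δ (x γ) :=
    Fintype.sum_equiv Fin.revPerm _ _ fun γ => by simp
  rw [quadForm, Derivation.map_smul, map_sum]
  simp only [Derivation.leibniz, smul_eq_mul, Finset.sum_add_distrib]
  rw [h, ← two_smul ℂ, smul_smul]
  norm_num

lemma map_quadForm (ψ : A →ₐ[ℂ] B) (x : Fin n → A) :
    ψ (quadForm x) = quadForm fun γ => ψ (x γ) := by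
  simp [quadForm]

end QuadraticForm

end InversionHierarchy
end

noncomputable section

namespace InversionHierarchy

open MvPowerSeries
open Finsupp hiding some

/-! ### The dilaton equation from tameness and topological recursion. -/

section DescendantPotential

variable {n : ℕ} [NeZero n] {F : Germ n} {F₀ : Big n ℂ}

omit [NeZero n] in
lemma sum_eta_smul {A : Type} [AddCommGroup A] [Module ℂ A] (f : Fin n → Fin n → A) :
    ∑ l, ∑ σ, eta l σ • f l σ = ∑ σ, f σ.rev σ := by
  rw [Finset.sum_comm]
  refine Finset.sum_congr rfl fun σ _ => ?_
  rw [Finset.sum_eq_single σ.rev]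
  · simp [eta]
  · intro l _ hl
    rw [eta, if_neg (fun h => hl (by rw [h, Fin.rev_rev])), zero_smul]
  · simp

omit [NeZero n] in
lemma IsDescendantPotential.coeff_eq_zero (hF₀ : IsDescendantPotential F F₀)
    {m : ℕ × Fin n →₀ ℕ} (hm : m.degree < (m.sum fun x k => k * x.1) + 3) : coeff m F₀ = 0 := by
  by_contra h
  exact absurd (hF₀.tame m h) (by omega)

omit [NeZero n] in
lemma IsDescendantPotential.coeff_eq_zero_of_degree (hF₀ : IsDescendantPotential F F₀)
    {m : ℕ × Fin n →₀ ℕ} (hm : m.degree < 3) : coeff m F₀ = 0 :=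
  hF₀.coeff_eq_zero (by omega)

omit [NeZero n] in
lemma IsDescendantPotential.small_third (hF₀ : IsDescendantPotential F F₀) (α β γ : Fin n) :
    dv α (dv β (dv γ (smallHom F₀))) = dv α (dv β (dv γ F)) := by
  ext m
  simp only [dv, coeff_pderiv]
  have := hF₀.primary (m + single α 1 + single β 1 + single γ 1) (by simp [map_add])
  rw [small_eq] at this
  rw [this]

lemma IsDescendantPotential.small_flat (hF : IsFrobeniusPotential F)
    (hF₀ : IsDescendantPotential F F₀) (β : Fin n) :
    smallHom (dt 0 β (dt 0 0 F₀)) = X β.rev := by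
  refine pderiv.ext (fun γ => ?_) ?_
  · rw [smallHom_dt, smallHom_dt, pderiv_comm β 0, pderiv_comm γ 0]
    have h := hF₀.small_third 0 γ β
    simp only [dv] at h
    rw [h, ← dv, ← dv, ← dv, hF.unit, eta, pderiv_X, Pi.single_apply]
    by_cases hγ : β = γ.rev
    · rw [if_pos hγ, if_pos (by rw [hγ, Fin.rev_rev]), map_one]
    · rw [if_neg hγ, if_neg (fun h => hγ (by rw [← h, Fin.rev_rev])), map_zero]
  · rw [constantCoeff_X, ← coeff_zero_eq_constantCoeff_apply, smallHom, coeff_killCompl, dt, dt,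
      coeff_pderiv, coeff_pderiv, hF₀.coeff_eq_zero_of_degree, zero_mul, zero_mul]
    simp

/-- Tameness removes degrees below three. Higher pure powers of `t^{0,1}` are absent because `∂_1³ F
= η_{11}`, which is zero for `n ≥ 2`. -/
lemma IsDescendantPotential.vanishesOnAxis (hn : 2 ≤ n) (hF : IsFrobeniusPotential F)
    (hF₀ : IsDescendantPotential F F₀) : VanishesOnAxis F₀ := fun m hm => by
  have h1 (x : ℕ × Fin n) (hx : x ≠ (0, 0)) : m x = 0 := by
    by_contra h
    have h1 : single x 1 ≤ m := by
      rw [single_le_iff]; exact Nat.one_le_iff_ne_zero.mpr h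
    have h2 : wt m = wt (m - single x 1) + wt (single x 1) := by
      rw [← map_add, tsub_add_cancel_of_le h1]
    rw [wt_single, if_neg hx] at h2
    split_ifs at h2 <;> omega
  have h2 : m = single (0, 0) (m (0, 0)) := by
    ext x
    by_cases hx : x = (0, 0)
    · subst hx; simp
    · rw [h1 x hx, single_eq_of_ne hx]
  by_cases h3 : m.degree < 3
  · exact hF₀.coeff_eq_zero_of_degree h3
  rw [h2, degree_single] at h3
  obtain ⟨k, hk⟩ : ∃ k, m (0, 0) = k + 3 := ⟨m (0, 0) - 3, by omega⟩
  have h4 := hF₀.primary (single 0 (k + 3)) (by rw [degree_single]; omega)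
  have h5 : coeff m F₀ = coeff (single (0 : Fin n) (k + 3)) (small F₀) := by
    rw [small_eq, smallHom, coeff_killCompl, embDomain_single, h2, hk]
    rfl
  have h6 := congrArg (coeff (single (0 : Fin n) k)) (hF.unit 0 0)
  rw [eta, if_neg (Ne.symm (rev_zero_ne hn)), map_zero, map_zero, dv, dv, dv, coeff_pderiv,
    coeff_pderiv, coeff_pderiv, ← single_add, ← single_add, ← single_add] at h6
  rw [h5, h4]
  simp only [single_eq_same, mul_eq_zero] at h6
  have hne (l : ℕ) : ((l : ℂ) + 1) ≠ 0 := by exact_mod_cast l.succ_ne_zero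
  have h7 : (single (0 : Fin n) (k + 1 + 1 + 1)) = single 0 (k + 3) := rfl
  have h8 : (k : ℂ) + 1 + 1 ≠ 0 := by exact_mod_cast (k + 1).succ_ne_zero
  have h9 : (k : ℂ) + 1 + 1 + 1 ≠ 0 := by exact_mod_cast (k + 1 + 1).succ_ne_zero
  push_cast at h6
  simpa only [hne k, h8, h9, or_false, h7] using h6

/-- The coordinates `v^σ`, restricted to the small phase space extended by `t^{1,1}`. -/
def flatCoord (F₀ : Big n ℂ) (σ : Fin n) : MvPowerSeries (Option (Fin n)) ℂ :=
  dilatonHom (dt 0 σ.rev (dt 0 0 F₀))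

/-- This is the recursion for `t^{1,1}`: its two-point factor involves `∂/∂t^{0,1}` and is therefore
a flat coordinate. -/
lemma IsDescendantPotential.pderiv_none (hF₀ : IsDescendantPotential F F₀) (p q : ℕ)
    (α β : Fin n) : pderiv ℂ none (dilatonHom (dt p α (dt q β F₀))) =
      ∑ σ, flatCoord F₀ σ * pderiv ℂ (some σ) (dilatonHom (dt p α (dt q β F₀))) := by
  rw [← dilatonHom_dt_one]
  have h := hF₀.trr 0 p q 0 α β
  rw [zero_add, sum_eta_smul] at h
  rw [h, map_sum]
  refine Finset.sum_congr rfl fun σ _ => ?_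
  rw [map_mul, flatCoord, dilatonHom_dt σ (dt p α _)]
  simp only [dt]
  rw [pderiv_comm (0, 0)]

/-- The coordinates `v^σ` obey a Burgers-type equation in `t^{1,1}` with initial value `t^{0,σ}`.
The defect `(1 - t^{1,1}) v^σ - t^{0,σ}` solves the same transport equation, now viewed as linear
with coefficients `v^μ`, and starts at zero. -/
lemma IsDescendantPotential.flatCoord_eq (hF : IsFrobeniusPotential F)
    (hF₀ : IsDescendantPotential F F₀) (σ : Fin n) :
    (1 - X none) * flatCoord F₀ σ = X (some σ) := by
  rw [← sub_eq_zero]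
  refine eq_zero_of_drop_eq_zero (c := flatCoord F₀) ?_ ?_
  · change dropHom _ = 0
    rw [map_sub, map_mul, map_sub, dropHom_X_none, dropHom_X, map_one, sub_zero, one_mul, flatCoord,
      dropHom_dilatonHom, hF₀.small_flat hF, Fin.rev_rev, sub_self]
  · have h := hF₀.pderiv_none 0 0 σ.rev 0
    rw [← flatCoord] at h
    have h1 (μ : Fin n) : pderiv ℂ (some μ) ((1 - X none) * flatCoord F₀ σ - X (some σ)) =
        (1 - X none) * pderiv ℂ (some μ) (flatCoord F₀ σ) - if μ = σ then 1 else 0 := by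
      rw [map_sub, Derivation.leibniz, map_sub, pderiv_one, pderiv_X_of_ne (by simp), pderiv_X,
        Pi.single_apply]
      simp [eq_comm]
    simp only [h1, mul_sub, Finset.sum_sub_distrib, mul_ite, mul_one, mul_zero,
      Finset.sum_ite_eq', Finset.mem_univ, if_true, mul_left_comm _ (1 - X none : MvPowerSeries (Option (Fin n)) ℂ)]
    rw [← Finset.mul_sum, ← h, map_sub, Derivation.leibniz, map_sub, pderiv_one,
      pderiv_X_self, pderiv_X_of_ne (by simp)]
    simp only [smul_eq_mul]
    ring

lemma IsDescendantPotential.dilaton (hF : IsFrobeniusPotential F)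
    (hF₀ : IsDescendantPotential F F₀) (p q : ℕ) (α β : Fin n) :
    (1 - X none) * pderiv ℂ none (dilatonHom (dt p α (dt q β F₀))) =
      ∑ σ, X (some σ) * pderiv ℂ (some σ) (dilatonHom (dt p α (dt q β F₀))) := by
  rw [hF₀.pderiv_none, Finset.mul_sum]
  refine Finset.sum_congr rfl fun σ _ => ?_
  rw [← mul_assoc, hF₀.flatCoord_eq hF]

omit [NeZero n] in
lemma pderiv_quadForm_X {R : Type} [CommRing R] [Algebra ℂ R] (β : Fin n) :
    pderiv R (some β) (quadForm fun γ : Fin n => X (some γ)) = X (some β.rev) := by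
  rw [← pderivC_apply, der_quadForm, Finset.sum_eq_single β]
  · rw [pderivC_apply, pderiv_X_self, mul_one]
  · intro γ _ hγ
    rw [pderivC_apply, pderiv_X_of_ne (by simpa using hγ), mul_zero]
  · simp

/-- The gradient in the `t^{0,μ}` is known from the flat coordinates, so only pure powers of
`t^{1,1}` remain to be excluded. -/
lemma IsDescendantPotential.dilatonHom_dt (hF : IsFrobeniusPotential F)
    (hF₀ : IsDescendantPotential F F₀) :
    (1 - X none) * dilatonHom (dt 0 0 F₀) = quadForm fun γ : Fin n => X (some γ) := by
  rw [← sub_eq_zero]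
  refine eq_zero_of_pderiv_some (fun μ => ?_) fun k => ?_
  · have h := hF₀.flatCoord_eq hF μ.rev
    rw [flatCoord, Fin.rev_rev, InversionHierarchy.dilatonHom_dt] at h
    rw [map_sub, pderiv_quadForm_X, ← h, Derivation.leibniz, map_sub, pderiv_one,
      pderiv_X_of_ne (by simp)]
    simp
  · let e : Unit ↪ Option (Fin n) := ⟨fun _ => none, fun _ _ _ => rfl⟩
    have hX (γ : Fin n) : killCompl e (X (some γ) : MvPowerSeries (Option (Fin n)) ℂ) = 0 :=
      killCompl_X_eq_zero (by rintro ⟨_, h⟩; cases h)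
    have hp : killCompl e (dilatonHom (dt 0 0 F₀)) = 0 := by
      refine MvPowerSeries.ext fun m => ?_
      rw [coeff_killCompl, dilatonHom, coeff_killCompl, dt, coeff_pderiv, hF₀.coeff_eq_zero]
      · simp
      -- The monomial `t^{0,1} (t^{1,1})^k` has degree `k + 1` and weight `k`, which tameness
      -- forbids.
      · obtain ⟨k, rfl⟩ : ∃ k, m = single () k := ⟨m (), by ext; simp⟩
        have he : (dilatonEmb (e ()) : ℕ × Fin n) = (1, 0) := rfl
        rw [embDomain_single, embDomain_single, he, map_add, degree_single, degree_single,
          sum_add_index (by simp) (by intros; ring), sum_single_index (by simp),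
          sum_single_index (by simp)]
        omega
    have h (f : MvPowerSeries (Option (Fin n)) ℂ) :
        coeff (single none k) f = coeff (single () k) (killCompl e f) := by
      rw [coeff_killCompl, embDomain_single]; rfl
    rw [h, map_sub, map_mul, hp, map_quadForm]
    simp [hX, quadForm]

end DescendantPotential

end InversionHierarchy
end

noncomputable section

namespace InversionHierarchy

open MvPowerSeries
open Finsupp hiding some

/-! ### The infinitesimal flow of the Hamiltonians. -/

section SmallFlow

variable {n : ℕ} [NeZero n] {R : Type} [CommRing R] [Algebra ℂ R]

/-- The operator `U`, over any coefficient ring. -/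
def flowOp (f : MvPowerSeries (Fin n) R) : MvPowerSeries (Fin n) R :=
  - (X (Fin.rev 0) * f) - quadForm (fun γ : Fin n => X γ) * pderiv R 0 f +
    X (Fin.rev 0) * ∑ γ : Fin n, X γ * pderiv R γ f

lemma opU_eq (f : Germ n) : opU f = flowOp f := by
  rw [opU, flowOp, quadForm, smul_mul_assoc]

lemma hamiltonian_eq (F₀ : Big n ℂ) (α : Fin n) (p : ℕ) :
    hamiltonian F₀ α p = smallHom (dt p α (dt 0 0 F₀)) := small_eq _

/-- At `t^{1,1} = 0` the first hypothesis gives `∂F₀ = ½ ∑ t^γ t^{n+1-γ}` and, after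
differentiation, `∂²F₀ = t^n`; the second replaces `∂/∂t^{1,1}` by the Euler field. These are the
three terms of `U`. Only these two identities enter, so the argument applies equally to the deformed
potentials. -/
lemma smallHom_dt_dt_hjZero (hn : 2 ≤ n) {g : Big n R} {α : Fin n} {p : ℕ}
    (hP : (1 - X none) * dilatonHom (dt 0 0 g) = quadForm fun γ : Fin n => X (some γ))
    (hD : (1 - X none) * pderiv R none (dilatonHom (dt p α (dt 0 0 g))) =
      ∑ γ, X (some γ) * pderiv R (some γ) (dilatonHom (dt p α (dt 0 0 g)))) :
    smallHom (dt p α (dt 0 0 (hjZero g))) = flowOp (smallHom (dt p α (dt 0 0 g))) +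
      if α = Fin.rev 0 then smallHom (dt (p + 1) 0 (dt 0 0 g)) else 0 := by
  have hq : dropHom (quadForm fun γ : Fin n => (X (some γ) : MvPowerSeries (Option (Fin n)) R)) =
      quadForm fun γ => X γ := by
    rw [← AlgHom.restrictScalars_apply ℂ, map_quadForm]
    simp only [AlgHom.restrictScalars_apply, dropHom_X]
  have hP' := congrArg dropHom hP
  have hD' := congrArg dropHom hD
  have hP1 := congrArg (fun f => dropHom (pderiv R (some (0 : Fin n)) f)) hP
  simp only [map_mul, map_sub, map_one, dropHom_X_none, dropHom_X, sub_zero, one_mul, map_sum, hq,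
    dropHom_pderiv] at hP' hD'
  simp only [pderiv_quadForm_X, Derivation.leibniz, map_sub, pderiv_one, smul_eq_mul,
    map_mul, pderiv_X_of_ne (show none ≠ some (0 : Fin n) by simp), map_one, dropHom_X_none,
    dropHom_X, sub_zero, one_mul, mul_zero, add_zero] at hP1
  rw [← dropHom_dilatonHom, dilatonHom_dt_dt_hjZero hn, map_add, map_sub, map_sub, map_mul, map_mul,
    map_mul, hP1, hP', hD', dropHom_X, dropHom_pderiv, flowOp, ← dropHom_dilatonHom,
    ← dropHom_dilatonHom]
  split_ifs
  · ring
  · rw [map_zero]; ring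

/-- The infinitesimal deformation of the Hamiltonians. -/
lemma hamiltonian_infDeform (hn : 2 ≤ n) {F : Germ n} (hF : IsFrobeniusPotential F)
    {F₀ : Big n ℂ} (hF₀ : IsDescendantPotential F F₀) (α : Fin n) (p : ℕ) :
    hamiltonian (infDeform F₀) α p = opU (hamiltonian F₀ α p) +
      if α = Fin.rev 0 then hamiltonian F₀ 0 (p + 1) else 0 := by
  rw [infDeform_eq hn (hF₀.vanishesOnAxis hn hF), opU_eq]
  simp only [hamiltonian_eq]
  exact smallHom_dt_dt_hjZero hn (hF₀.dilatonHom_dt hF) (hF₀.dilaton hF p 0 α 0)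

end SmallFlow

/-! ### The dilaton operator and its commutators. -/

section DilatonOperator

variable {n : ℕ} {R : Type} [CommRing R]

/-- The operator `(1 - t^{1,1}) ∂/∂t^{1,1} - ∑_γ t^{0,γ} ∂/∂t^{0,γ}`. -/
def dilatonOp (f : MvPowerSeries (Option (Fin n)) R) : MvPowerSeries (Option (Fin n)) R :=
  pderiv R none f - ∑ i, X i * pderiv R i f

lemma dilatonOp_eq_zero_iff (f : MvPowerSeries (Option (Fin n)) R) :
    dilatonOp f = 0 ↔
      (1 - X none) * pderiv R none f = ∑ γ, X (some γ) * pderiv R (some γ) f := by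
  rw [dilatonOp, Fintype.sum_option, sub_mul, one_mul, sub_add_eq_sub_sub, sub_eq_zero]

lemma dilatonOp_mul (f g : MvPowerSeries (Option (Fin n)) R) :
    dilatonOp (f * g) = f * dilatonOp g + g * dilatonOp f := by
  simp only [dilatonOp, Derivation.leibniz, smul_eq_mul, mul_add, Finset.sum_add_distrib, mul_sub,
    Finset.mul_sum, mul_left_comm (X _)]
  ring

lemma dilatonOp_add (f g : MvPowerSeries (Option (Fin n)) R) :
    dilatonOp (f + g) = dilatonOp f + dilatonOp g := by
  simp only [dilatonOp, map_add, mul_add, Finset.sum_add_distrib]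
  ring

lemma dilatonOp_sub (f g : MvPowerSeries (Option (Fin n)) R) :
    dilatonOp (f - g) = dilatonOp f - dilatonOp g := by
  simp only [dilatonOp, map_sub, mul_sub, Finset.sum_sub_distrib]
  ring

lemma dilatonOp_zero : dilatonOp (0 : MvPowerSeries (Option (Fin n)) R) = 0 := by
  simp [dilatonOp]

lemma dilatonOp_X_some (γ : Fin n) :
    dilatonOp (X (some γ) : MvPowerSeries (Option (Fin n)) R) = - X (some γ) := by
  rw [dilatonOp, pderiv_X_of_ne (by simp), Finset.sum_eq_single (some γ)]
  · simp
  · intro i _ hi; rw [pderiv_X_of_ne (Ne.symm hi), mul_zero]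
  · simp

lemma dilatonOp_one_sub_X :
    dilatonOp (1 - X none : MvPowerSeries (Option (Fin n)) R) = - (1 - X none) := by
  rw [dilatonOp, Finset.sum_eq_single none]
  · simp only [map_sub, pderiv_one, pderiv_X_self]; ring
  · intro i _ hi; rw [map_sub, pderiv_one, pderiv_X_of_ne (Ne.symm hi), sub_zero, mul_zero]
  · simp

/-- The operator is a translation minus the Euler field. Only the Euler part fails to commute with
partial derivatives, and it contributes one unit of degree. -/
lemma dilatonOp_pderiv (i : Option (Fin n)) (f : MvPowerSeries (Option (Fin n)) R) :
    dilatonOp (pderiv R i f) = pderiv R i (dilatonOp f) + pderiv R i f := by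
  have h : ∑ j, pderiv R j f * pderiv R i (X j) = pderiv R i f := by
    rw [Finset.sum_eq_single i]
    · simp
    · intro j _ hj; rw [pderiv_X_of_ne hj, mul_zero]
    · simp
  simp only [dilatonOp, map_sub, map_sum, Derivation.leibniz, smul_eq_mul, Finset.sum_add_distrib,
    h, pderiv_comm i]
  ring

lemma dilatonOp_quadForm [Algebra ℂ R] :
    dilatonOp (quadForm fun γ : Fin n => (X (some γ) : MvPowerSeries (Option (Fin n)) R)) =
      - (2 * quadForm fun γ : Fin n => X (some γ)) := by
  rw [dilatonOp, Fintype.sum_option]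
  simp only [pderiv_quadForm_X]
  have h : pderiv R none
      (quadForm fun γ : Fin n => (X (some γ) : MvPowerSeries (Option (Fin n)) R)) = 0 := by
    rw [← pderivC_apply, der_quadForm]
    refine Finset.sum_eq_zero fun γ _ => ?_
    rw [pderivC_apply, pderiv_X_of_ne (by simp), mul_zero]
  rw [h, mul_zero, zero_add, zero_sub, quadForm, two_mul, ← add_smul]
  norm_num

/-- The quadratic form has eigenvalue `-2` and `1 - t^{1,1}` has eigenvalue `-1`, so the quotient
has eigenvalue `-1`. -/
lemma dilatonOp_of_mul_eq_quadForm [Algebra ℂ R] [IsDomain R]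
    {p : MvPowerSeries (Option (Fin n)) R}
    (hp : (1 - X none) * p = quadForm fun γ : Fin n => X (some γ)) : dilatonOp p = - p := by
  have h := congrArg dilatonOp hp
  rw [dilatonOp_quadForm, ← hp, dilatonOp_mul, dilatonOp_one_sub_X] at h
  have h1 : (1 - X none : MvPowerSeries (Option (Fin n)) R) ≠ 0 := fun h0 => by
    have := congrArg constantCoeff h0
    simp at this
  refine mul_left_cancel₀ h1 ?_
  linear_combination h

end DilatonOperator

/-! ### Propagation of the dilaton equation along the deformation. -/

section PolynomialFlow

/-- Uniqueness for linear differential equations in the deformation parameter. -/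
lemma eq_zero_of_flow {ι : Type} {r : MvPowerSeries ι (Polynomial ℂ)}
    (L : MvPowerSeries ι (Polynomial ℂ) → MvPowerSeries ι (Polynomial ℂ))
    (hL : ∀ (c : Polynomial ℂ) f, L (C c * f) = C c * L f)
    (h : coeffDer derS r = L r)
    (h0 : MvPowerSeries.map (evalS 0 : Polynomial ℂ →+* ℂ) r = 0) : r = 0 := by
  have H (k : ℕ) : ∀ m, (Polynomial.X : Polynomial ℂ) ^ k ∣ coeff m r := by
    induction k with
    | zero => simp
    | succ k ih =>
      obtain ⟨q, hq⟩ : ∃ q : MvPowerSeries ι (Polynomial ℂ),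
          ∀ m, coeff m r = Polynomial.X ^ k * coeff m q :=
        ⟨fun m => (ih m).choose, fun m => (ih m).choose_spec⟩
      have hr : r = C ((Polynomial.X : Polynomial ℂ) ^ k) * q :=
        MvPowerSeries.ext fun m => by rw [coeff_C_mul]; exact hq m
      intro m
      rw [Polynomial.X_pow_dvd_iff]
      intro d hd
      rcases d with _ | d
      · have := congrArg (coeff m) h0
        rw [coeff_map, map_zero] at this
        rw [Polynomial.coeff_zero_eq_eval_zero, ← Polynomial.coe_aeval_eq_eval]
        exact this
      -- If `r = s^k q`, linearity over `ℂ[s]` gives `∂_s r = s^k L q`. With the zero initial value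
      -- this improves divisibility from `s^k` to `s^{k+1}`.
      · have h1 : Polynomial.derivative (coeff m r) = Polynomial.X ^ k * coeff m (L q) := by
          rw [← coeff_C_mul, ← hL, ← hr, ← h]; rfl
        have h2 := congrArg (fun p => Polynomial.coeff p d) h1
        simp only [Polynomial.coeff_derivative, Polynomial.coeff_X_pow_mul'] at h2
        rw [if_neg (by omega)] at h2
        have hd1 : (d : ℂ) + 1 ≠ 0 := by exact_mod_cast d.succ_ne_zero
        exact (mul_eq_zero.mp h2).resolve_right hd1
  ext m d
  rw [Polynomial.X_pow_dvd_iff.mp (H (d + 1) m) d (Nat.lt_succ_self d)]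
  simp

lemma coeffDer_pderiv {ι : Type} (i : ι) (f : MvPowerSeries ι (Polynomial ℂ)) :
    coeffDer derS (pderiv (Polynomial ℂ) i f) = pderiv (Polynomial ℂ) i (coeffDer derS f) := by
  rw [coeffDer_apply, coeffDer_apply, coeffMap_pderiv]

lemma coeffDer_X {ι : Type} (i : ι) : coeffDer derS (X i : MvPowerSeries ι (Polynomial ℂ)) = 0 := by
  classical
  ext1 m
  rw [coeffDer_apply, coeff_coeffMap, coeff_X]
  change derS _ = 0
  split_ifs <;> simp

lemma coeffDer_C {ι : Type} (c : Polynomial ℂ) :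
    coeffDer derS (C c : MvPowerSeries ι (Polynomial ℂ)) = C (derS c) := by
  classical
  ext1 m
  rw [coeffDer_apply, coeff_coeffMap, coeff_C, coeff_C]
  change derS _ = _
  split_ifs <;> simp

lemma coeffDer_dilatonOp {n : ℕ} (f : MvPowerSeries (Option (Fin n)) (Polynomial ℂ)) :
    coeffDer derS (dilatonOp f) = dilatonOp (coeffDer derS f) := by
  simp only [dilatonOp, map_sub, map_sum, Derivation.leibniz, coeffDer_X, mul_zero, add_zero,
    smul_eq_mul, coeffDer_pderiv]

lemma map_dilatonOp {n : ℕ} {R S : Type} [CommRing R] [CommRing S] (ψ : R →+* S)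
    (f : MvPowerSeries (Option (Fin n)) R) :
    MvPowerSeries.map ψ (dilatonOp f) = dilatonOp (MvPowerSeries.map ψ f) := by
  simp only [dilatonOp, map_sub, map_sum, map_mul, map_X, map_pderiv]

lemma pderiv_C_mul {ι R : Type} [CommRing R] (i : ι) (c : R) (f : MvPowerSeries ι R) :
    pderiv R i (C c * f) = C c * pderiv R i f := by
  rw [← smul_eq_C_mul, Derivation.map_smul, smul_eq_C_mul]

variable {n : ℕ} [NeZero n]

lemma coeffDer_dilatonHom (f : Big n (Polynomial ℂ)) :
    coeffDer derS (dilatonHom f) = dilatonHom (coeffDer derS f) := by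
  rw [coeffDer_apply, coeffDer_apply, dilatonHom, coeffMap_killCompl]

omit [NeZero n] in
lemma coeffDer_smallHom (f : Big n (Polynomial ℂ)) :
    coeffDer derS (smallHom f) = smallHom (coeffDer derS f) := by
  rw [coeffDer_apply, coeffDer_apply, smallHom, coeffMap_killCompl]

lemma map_dilatonHom {R S : Type} [CommRing R] [CommRing S] (ψ : R →+* S) (f : Big n R) :
    MvPowerSeries.map ψ (dilatonHom f) = dilatonHom (MvPowerSeries.map ψ f) :=
  (killCompl_map ψ f).symm

omit [NeZero n] in
lemma map_smallHom {R S : Type} [CommRing R] [CommRing S] (ψ : R →+* S) (f : Big n R) :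
    MvPowerSeries.map ψ (smallHom f) = smallHom (MvPowerSeries.map ψ f) :=
  (killCompl_map ψ f).symm

omit [NeZero n] in
lemma map_dt {R S : Type} [CommRing R] [CommRing S] (ψ : R →+* S) (p : ℕ) (α : Fin n)
    (f : Big n R) : MvPowerSeries.map ψ (dt p α f) = dt p α (MvPowerSeries.map ψ f) :=
  map_pderiv _ _ _

lemma map_smul_complex {ι R S : Type} [CommRing R] [CommRing S] [Algebra ℂ R] [Algebra ℂ S]
    (ψ : R →ₐ[ℂ] S) (c : ℂ) (f : MvPowerSeries ι R) :
    MvPowerSeries.map (ψ : R →+* S) (c • f) = c • MvPowerSeries.map (ψ : R →+* S) f :=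
  MvPowerSeries.ext fun m => map_smul ψ c (coeff m f)

omit [NeZero n] in
lemma map_quadForm_X {ι R S : Type} [CommRing R] [CommRing S] [Algebra ℂ R] [Algebra ℂ S]
    (ψ : R →ₐ[ℂ] S) (x : Fin n → ι) :
    MvPowerSeries.map (ψ : R →+* S) (quadForm fun γ => X (x γ)) = quadForm fun γ => X (x γ) := by
  simp only [quadForm, map_smul_complex, map_sum, map_mul, map_X]

/-- A polynomial family of genus zero potentials deforming `F₀` by the Hamilton–Jacobi
equation. -/
structure IsDeformation (F₀ : Big n ℂ) (g : Big n (Polynomial ℂ)) : Prop where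
  flow : coeffDer derS g = hjZero g
  initial : MvPowerSeries.map (evalS 0 : Polynomial ℂ →+* ℂ) g = F₀

variable {F : Germ n} {F₀ : Big n ℂ} {g : Big n (Polynomial ℂ)}

/-- The restricted `∂g` is stationary. It satisfies a nonlinear equation, but its defect from the
asserted formula satisfies a linear one whose coefficient is `∂g` itself, so the initial value
decides. -/
lemma IsDeformation.dilatonHom_dt (hn : 2 ≤ n) (hF : IsFrobeniusPotential F)
    (hF₀ : IsDescendantPotential F F₀) (hg : IsDeformation F₀ g) :
    (1 - X none) * dilatonHom (dt 0 0 g) = quadForm fun γ : Fin n => X (some γ) := by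
  set p := dilatonHom (dt 0 0 g) with hp
  have hflow : coeffDer derS p = X (some (Fin.rev 0)) * pderiv _ none p -
      p * pderiv _ (some (0 : Fin n)) p := by
    rw [hp, coeffDer_dilatonHom]
    simp only [dt]
    rw [coeffDer_pderiv, hg.flow]
    exact dilatonHom_dt_hjZero hn g
  have hq : coeffDer derS (quadForm fun γ : Fin n =>
      (X (some γ) : MvPowerSeries (Option (Fin n)) (Polynomial ℂ))) = 0 := by
    rw [der_quadForm]
    simp only [coeffDer_X, mul_zero, Finset.sum_const_zero]
  have hqn : pderiv (Polynomial ℂ) none (quadForm fun γ : Fin n =>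
      (X (some γ) : MvPowerSeries (Option (Fin n)) (Polynomial ℂ))) = 0 := by
    rw [← pderivC_apply, der_quadForm]
    refine Finset.sum_eq_zero fun γ _ => ?_
    rw [pderivC_apply, pderiv_X_of_ne (by simp), mul_zero]
  rw [← sub_eq_zero]
  refine eq_zero_of_flow (fun f => X (some (Fin.rev 0)) * pderiv _ none f -
    p * pderiv _ (some (0 : Fin n)) f) (fun c f => ?_) ?_ ?_
  · simp only [pderiv_C_mul]; ring
  · simp only [map_sub, Derivation.leibniz, hq, hqn, pderiv_quadForm_X, hflow,
      pderiv_X_self, pderiv_X_of_ne (show none ≠ some (0 : Fin n) by simp), coeffDer_X,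
      Derivation.map_one_eq_zero, smul_eq_mul]
    ring
  · rw [map_sub, map_mul, map_sub, map_one, map_X, hp, map_dilatonHom, map_dt, hg.initial,
      hF₀.dilatonHom_dt hF, map_quadForm_X (evalS 0), sub_self]

lemma IsDeformation.flow_dilatonHom (hn : 2 ≤ n) (hg : IsDeformation F₀ g) (α : Fin n) (q : ℕ) :
    coeffDer derS (dilatonHom (dt q α (dt 0 0 g))) =
      X (some (Fin.rev 0)) * pderiv _ none (dilatonHom (dt q α (dt 0 0 g))) -
        pderiv _ (some (0 : Fin n)) (dilatonHom (dt 0 0 g)) * dilatonHom (dt q α (dt 0 0 g)) -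
        dilatonHom (dt 0 0 g) * pderiv _ (some (0 : Fin n)) (dilatonHom (dt q α (dt 0 0 g))) +
        if α = Fin.rev 0 then dilatonHom (dt (q + 1) 0 (dt 0 0 g)) else 0 := by
  rw [← dilatonHom_dt_dt_hjZero hn, coeffDer_dilatonHom]
  simp only [dt]
  rw [coeffDer_pderiv, coeffDer_pderiv, hg.flow]

/-- Applying the dilaton operator to the flow of a two-point function gives the same linear flow for
the result: the eigenvalues of `t^{0,n}` and `∂g` cancel those produced by the commutators. -/
lemma IsDeformation.dilatonOp_eq_zero (hn : 2 ≤ n) (hF : IsFrobeniusPotential F)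
    (hF₀ : IsDescendantPotential F F₀) (hg : IsDeformation F₀ g) (α : Fin n) (q : ℕ) :
    dilatonOp (dilatonHom (dt q α (dt 0 0 g))) = 0 := by
  have hp := dilatonOp_of_mul_eq_quadForm (hg.dilatonHom_dt hn hF hF₀)
  set p := dilatonHom (dt 0 0 g) with hp'
  have hp1 : dilatonOp (pderiv _ (some (0 : Fin n)) p) = 0 := by
    rw [dilatonOp_pderiv, hp, map_neg, neg_add_cancel]
  have key (α : Fin n) (q : ℕ)
      (h : dilatonOp (if α = Fin.rev 0 then dilatonHom (dt (q + 1) 0 (dt 0 0 g)) else 0) = 0) :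
      dilatonOp (dilatonHom (dt q α (dt 0 0 g))) = 0 := by
    refine eq_zero_of_flow (fun f => X (some (Fin.rev 0)) * pderiv _ none f -
      pderiv _ (some (0 : Fin n)) p * f - p * pderiv _ (some (0 : Fin n)) f) (fun c f => ?_) ?_ ?_
    · simp only [pderiv_C_mul]; ring
    · rw [coeffDer_dilatonOp, hg.flow_dilatonHom hn, dilatonOp_add, h, dilatonOp_sub, dilatonOp_sub,
        dilatonOp_mul, dilatonOp_mul, dilatonOp_mul, hp, hp1, dilatonOp_X_some, dilatonOp_pderiv,
        dilatonOp_pderiv]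
      ring
    · rw [map_dilatonOp, map_dilatonHom, map_dt, map_dt, hg.initial, dilatonOp_eq_zero_iff]
      exact hF₀.dilaton hF q 0 α 0
  -- For `α = n` the source is the function with indices `(1, q + 1)`. Its own flow has no source
  -- because `1 ≠ n`, so two applications suffice.
  refine key α q ?_
  split_ifs
  · refine key 0 (q + 1) ?_
    rw [if_neg (Ne.symm (rev_zero_ne hn)), dilatonOp_zero]
  · exact dilatonOp_zero

lemma IsDeformation.flow_smallHom (hn : 2 ≤ n) (hF : IsFrobeniusPotential F)
    (hF₀ : IsDescendantPotential F F₀) (hg : IsDeformation F₀ g) (α : Fin n) (q : ℕ) :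
    coeffDer derS (smallHom (dt q α (dt 0 0 g))) = flowOp (smallHom (dt q α (dt 0 0 g))) +
      if α = Fin.rev 0 then smallHom (dt (q + 1) 0 (dt 0 0 g)) else 0 := by
  rw [← smallHom_dt_dt_hjZero hn (hg.dilatonHom_dt hn hF hF₀)
    ((dilatonOp_eq_zero_iff _).mp (hg.dilatonOp_eq_zero hn hF hF₀ α q)), coeffDer_smallHom]
  simp only [dt]
  rw [coeffDer_pderiv, coeffDer_pderiv, hg.flow]

end PolynomialFlow

end InversionHierarchy
end

noncomputable section

namespace InversionHierarchy

open MvPowerSeries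
open Finsupp hiding some

/-! ### Substitution, derivations and change of coefficients. -/

section Substitution

variable {ι σ R S : Type} [CommRing R] [Algebra ℂ R] [CommRing S] [Algebra ℂ S]

lemma coeff_subst_eq_zero {a : ι → MvPowerSeries σ R} (ha : HasSubst a)
    (h0 : ∀ i, constantCoeff (a i) = 0) {f : MvPowerSeries ι ℂ} {N : ℕ}
    (hf : ∀ m : ι →₀ ℕ, m.degree < N → coeff m f = 0) {m : σ →₀ ℕ} (hm : m.degree < N) :
    coeff m (subst a f) = 0 := by
  refine coeff_of_lt_order (lt_of_lt_of_le (b := (N : ℕ∞)) (by exact_mod_cast hm) ?_)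
  refine le_trans ?_ (le_order_subst ha f)
  have h1 : (1 : ℕ∞) ≤ ⨅ i, (a i).order :=
    le_iInf fun i => one_le_order_iff_constCoeff_eq_zero.mpr (h0 i)
  have h2 : (N : ℕ∞) ≤ f.order := nat_le_order fun m hm => hf m (by exact_mod_cast hm)
  calc (N : ℕ∞) = 1 * N := (one_mul _).symm
    _ ≤ _ := mul_le_mul' h1 h2

lemma der_aeval_eq_zero (δ : Derivation ℂ (MvPowerSeries σ R) (MvPowerSeries σ R))
    {a : ι → MvPowerSeries σ R} (ha : ∀ i, δ (a i) = 0) (p : MvPolynomial ι ℂ) :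
    δ (MvPolynomial.aeval a p) = 0 := by
  induction p using MvPolynomial.induction_on with
  | C c => rw [MvPolynomial.aeval_C, Derivation.map_algebraMap]
  | add p q hp hq => rw [map_add, map_add, hp, hq, add_zero]
  | mul_X p i hp => rw [map_mul, Derivation.leibniz, MvPolynomial.aeval_X, ha, hp, smul_zero,
      smul_zero, add_zero]

/-- Polynomials in functions annihilated by `δ` are annihilated by the Leibniz rule. The truncated
tail has too high an order to affect the coefficient in question. -/
lemma der_subst_eq_zero [Finite ι] (δ : Derivation ℂ (MvPowerSeries σ R) (MvPowerSeries σ R))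
    (hδ : DegreeLocal δ) {a : ι → MvPowerSeries σ R} (h0 : ∀ i, constantCoeff (a i) = 0)
    (ha : ∀ i, δ (a i) = 0) (f : MvPowerSeries ι ℂ) : δ (subst a f) = 0 := by
  classical
  have hs : HasSubst a := hasSubst_of_constantCoeff_zero h0
  ext m
  set p := truncTotal (m.degree + 2) f with hp
  have h1 : subst a f = subst a (f - (p : MvPowerSeries ι ℂ)) + MvPolynomial.aeval a p := by
    rw [subst_sub hs, subst_coe, sub_add_cancel]
  rw [h1, map_add, der_aeval_eq_zero δ ha, add_zero, map_zero]
  refine hδ _ _ fun m' hm' => coeff_subst_eq_zero hs h0 (N := m.degree + 2) (fun k hk => ?_)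
    (by omega)
  rw [map_sub, MvPolynomial.coeff_coe, hp, coeff_truncTotal_eq_ite, if_pos hk, sub_self]

lemma map_subst_algHom (ψ : R →ₐ[ℂ] S) {a : ι → MvPowerSeries σ R} (ha : HasSubst a)
    (f : MvPowerSeries ι ℂ) :
    MvPowerSeries.map (ψ : R →+* S) (subst a f) =
      subst (fun i => MvPowerSeries.map (ψ : R →+* S) (a i)) f := by
  ext m
  have (r : R) : (ψ : R →+* S) r = (ψ : R →+* S).toAddMonoidHom r := rfl
  rw [coeff_subst (ha.map _), coeff_map, coeff_subst ha, this, AddMonoidHom.map_finsum _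
    (coeff_subst_finite ha _ _), finsum_congr]
  intro d
  rw [← this, AlgHom.coe_toRingHom, map_smul, ← AlgHom.coe_toRingHom, ← coeff_map, Finsupp.prod,
    map_prod]
  simp only [map_pow, Finsupp.prod]

end Substitution

/-! ### Integration of `U` by characteristics. -/

section ScalingSolution

variable {n : ℕ} [NeZero n]

/-- The conformal factor `1 - s v^n`. -/
def scaleS : MvPowerSeries (Fin n) (Polynomial ℂ) := 1 - C Polynomial.X * X (Fin.rev 0)

/-- Its inverse. -/
def scaleInv : MvPowerSeries (Fin n) (Polynomial ℂ) := invOfUnit scaleS 1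

/-- The flow of the vector field of `U` on the coordinates. -/
def coordS (μ : Fin n) : MvPowerSeries (Fin n) (Polynomial ℂ) :=
  if μ = 0 then (X 0 - C Polynomial.X * quadForm fun γ => X γ) * scaleInv else X μ * scaleInv

lemma scaleS_mul_scaleInv : (scaleS : MvPowerSeries (Fin n) (Polynomial ℂ)) * scaleInv = 1 :=
  mul_invOfUnit _ _ (by simp [scaleS])

omit [NeZero n] in
lemma constantCoeff_quadForm_X {R : Type} [CommRing R] [Algebra ℂ R] :
    constantCoeff (quadForm fun γ : Fin n => (X γ : MvPowerSeries (Fin n) R)) = 0 := by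
  rw [quadForm, ← coeff_zero_eq_constantCoeff_apply, coeff_smul_complex,
    coeff_zero_eq_constantCoeff_apply, map_sum]
  simp

lemma constantCoeff_coordS (μ : Fin n) : constantCoeff (coordS μ) = 0 := by
  rw [coordS]
  split_ifs <;> simp [constantCoeff_quadForm_X]

lemma hasSubst_coordS : HasSubst (coordS (n := n)) :=
  hasSubst_of_constantCoeff_zero constantCoeff_coordS

/-- The transport operator `∂/∂s - v^n ∑_γ v^γ ∂_γ + (1/2) ∑_γ v^γ v^{n+1-γ} ∂_1`. -/
def transport : Derivation ℂ (MvPowerSeries (Fin n) (Polynomial ℂ))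
    (MvPowerSeries (Fin n) (Polynomial ℂ)) :=
  coeffDer derS - (X (Fin.rev 0) : MvPowerSeries (Fin n) (Polynomial ℂ)) •
    ∑ γ : Fin n, (X γ : MvPowerSeries (Fin n) (Polynomial ℂ)) • pderivC γ +
    (quadForm fun γ : Fin n => (X γ : MvPowerSeries (Fin n) (Polynomial ℂ))) • pderivC 0

lemma transport_apply (f : MvPowerSeries (Fin n) (Polynomial ℂ)) :
    transport f = coeffDer derS f - X (Fin.rev 0) * ∑ γ : Fin n, X γ * pderiv _ γ f +
      (quadForm fun γ : Fin n => X γ) * pderiv _ 0 f := by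
  simp only [transport, Derivation.add_apply, Derivation.sub_apply, Derivation.smul_apply,
    smul_eq_mul, pderivC_apply]
  congr 3
  rw [← Derivation.coeFnAddMonoidHom_apply, map_sum, Finset.sum_apply]
  simp only [Derivation.coeFnAddMonoidHom_apply, Derivation.smul_apply, smul_eq_mul, pderivC_apply]

lemma coeffDer_eq_flowOp_iff (f : MvPowerSeries (Fin n) (Polynomial ℂ)) :
    coeffDer derS f = flowOp f ↔ transport f = - (X (Fin.rev 0) * f) := by
  rw [transport_apply, flowOp]
  constructor <;> intro h <;> linear_combination h

lemma degreeLocal_transport : DegreeLocal (transport (n := n)) := fun f m h => by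
  have hd (γ : Fin n) (m' : Fin n →₀ ℕ) (hm' : m'.degree ≤ m.degree) :
      coeff m' (pderiv (Polynomial ℂ) γ f) = 0 :=
    degreeLocal_pderiv γ f m' fun k hk => h k (by omega)
  rw [transport_apply, map_add, map_sub, degreeLocal_coeffDer derS f m h,
    coeff_mul_eq_zero_of_right (fun m' hm' => ?_), coeff_mul_eq_zero_of_right (fun m' hm' => ?_)]
  · simp
  · exact hd 0 m' hm'
  · rw [map_sum]
    exact Finset.sum_eq_zero fun γ _ => coeff_mul_eq_zero_of_right fun k hk =>
      hd γ k (le_trans hk hm')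

lemma transport_X (μ : Fin n) : transport (X μ) =
    - (X (Fin.rev 0) * X μ) + if μ = 0 then quadForm fun γ : Fin n => X γ else 0 := by
  rw [transport_apply, coeffDer_X, Finset.sum_eq_single μ]
  · rw [pderiv_X_self]
    split_ifs with h
    · rw [h, pderiv_X_self]; ring
    · rw [pderiv_X_of_ne h]; ring
  · intro γ _ hγ; rw [pderiv_X_of_ne hγ.symm, mul_zero]
  · simp

lemma transport_quadForm : transport (quadForm fun γ : Fin n => X γ) =
    - (X (Fin.rev 0) * quadForm fun γ : Fin n => X γ) := by
  rw [der_quadForm]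
  simp only [transport_X, mul_add, mul_ite, mul_zero, Finset.sum_add_distrib,
    Finset.sum_ite_eq', Finset.mem_univ, if_true]
  have h : ∑ γ : Fin n, X γ.rev * -(X (Fin.rev 0) * X γ) =
      - (2 * (X (Fin.rev 0) * quadForm fun γ : Fin n =>
        (X γ : MvPowerSeries (Fin n) (Polynomial ℂ)))) := by
    have h2 : 2 * quadForm (fun γ : Fin n => (X γ : MvPowerSeries (Fin n) (Polynomial ℂ))) =
        ∑ γ : Fin n, X γ * X γ.rev := by
      rw [quadForm, two_mul, ← add_smul]; norm_num
    rw [mul_left_comm, h2, Finset.mul_sum, ← Finset.sum_neg_distrib]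
    exact Finset.sum_congr rfl fun γ _ => by ring
  rw [h]; ring

lemma transport_C (c : Polynomial ℂ) :
    transport (C c : MvPowerSeries (Fin n) (Polynomial ℂ)) = C (derS c) := by
  rw [transport_apply, coeffDer_C]
  simp

lemma transport_scaleS (hn : 2 ≤ n) :
    transport (scaleS (n := n)) = - (X (Fin.rev 0) * scaleS) := by
  have hd : derS Polynomial.X = 1 := Polynomial.derivative_X
  rw [scaleS, map_sub, Derivation.map_one_eq_zero, Derivation.leibniz, transport_C, transport_X,
    if_neg (rev_zero_ne hn), hd, map_one, smul_eq_mul, smul_eq_mul]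
  ring

lemma transport_scaleInv (hn : 2 ≤ n) :
    transport (scaleInv (n := n)) = X (Fin.rev 0) * scaleInv := by
  have h := congrArg transport (scaleS_mul_scaleInv (n := n))
  rw [Derivation.leibniz, transport_scaleS hn, Derivation.map_one_eq_zero, smul_eq_mul,
    smul_eq_mul] at h
  have h1 := scaleS_mul_scaleInv (n := n)
  linear_combination scaleInv * h - (transport scaleInv - X (Fin.rev 0) * scaleInv) * h1

/-- The components of `coordS` are first integrals of the transport field: numerator and denominator
are both multiplied by `-v^n`. In the first component, the quadratic term from transporting `v^1`
cancels the `s`-derivative of the explicit correction. -/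
lemma transport_coordS (hn : 2 ≤ n) (μ : Fin n) : transport (coordS μ) = 0 := by
  have hd : derS Polynomial.X = 1 := Polynomial.derivative_X
  rw [coordS]
  split_ifs with h
  · rw [Derivation.leibniz, map_sub, Derivation.leibniz, transport_C, transport_X, if_pos rfl,
      transport_quadForm, transport_scaleInv hn, hd, map_one, smul_eq_mul, smul_eq_mul,
      smul_eq_mul, smul_eq_mul]
    ring
  · rw [Derivation.leibniz, transport_X, if_neg h, transport_scaleInv hn, smul_eq_mul, smul_eq_mul]
    ring

/-- The solution of the equation `∂f/∂s = U f` with initial value `f`. -/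
def flowSol (f : Germ n) : MvPowerSeries (Fin n) (Polynomial ℂ) := scaleS * subst coordS f

lemma coeffDer_flowSol (hn : 2 ≤ n) (f : Germ n) :
    coeffDer derS (flowSol f) = flowOp (flowSol f) := by
  rw [coeffDer_eq_flowOp_iff, flowSol, Derivation.leibniz, transport_scaleS hn,
    der_subst_eq_zero transport degreeLocal_transport constantCoeff_coordS (transport_coordS hn),
    smul_eq_mul, smul_eq_mul]
  ring

lemma map_flowSol (ψ : Polynomial ℂ →ₐ[ℂ] ℂ) (f : Germ n) :
    MvPowerSeries.map (ψ : Polynomial ℂ →+* ℂ) (flowSol f) =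
      (1 - C (ψ Polynomial.X) * X (Fin.rev 0)) *
        subst (fun μ => MvPowerSeries.map (ψ : Polynomial ℂ →+* ℂ) (coordS μ)) f := by
  rw [flowSol, map_mul, map_subst_algHom ψ hasSubst_coordS, scaleS, map_sub, map_one, map_mul,
    map_C, map_X]
  rfl

lemma map_zero_flowSol (f : Germ n) :
    MvPowerSeries.map (evalS 0 : Polynomial ℂ →+* ℂ) (flowSol f) = f := by
  have hX : evalS 0 Polynomial.X = 0 := Polynomial.aeval_X _
  have hX' : (evalS 0 : Polynomial ℂ →+* ℂ) Polynomial.X = 0 := hX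
  have hI : MvPowerSeries.map (evalS 0 : Polynomial ℂ →+* ℂ) (scaleInv (n := n)) = 1 := by
    have h := congrArg (MvPowerSeries.map (evalS 0 : Polynomial ℂ →+* ℂ))
      (scaleS_mul_scaleInv (n := n))
    rw [map_mul, scaleS, map_sub, map_one, map_mul, map_C, hX'] at h
    simpa using h
  have hc : (fun μ : Fin n => MvPowerSeries.map (evalS 0 : Polynomial ℂ →+* ℂ) (coordS μ)) =
      X := by
    funext μ
    rw [coordS]
    split_ifs with h
    · rw [map_mul, hI, map_sub, map_mul, map_C, hX', map_X, h]; simp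
    · rw [map_mul, hI, map_X, mul_one]
  rw [map_flowSol, hX, hc, subst_self]
  simp

lemma flowOp_add (f g : MvPowerSeries (Fin n) (Polynomial ℂ)) :
    flowOp (f + g) = flowOp f + flowOp g := by
  simp only [flowOp, map_add, mul_add, Finset.sum_add_distrib]
  ring

lemma flowOp_C_mul (c : Polynomial ℂ) (f : MvPowerSeries (Fin n) (Polynomial ℂ)) :
    flowOp (C c * f) = C c * flowOp f := by
  simp only [flowOp, pderiv_C_mul, mul_left_comm _ (C c), ← Finset.mul_sum]
  ring

lemma flowOp_sub (f g : MvPowerSeries (Fin n) (Polynomial ℂ)) :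
    flowOp (f - g) = flowOp f - flowOp g := by
  simp only [flowOp, map_sub, mul_sub, Finset.sum_sub_distrib]
  ring

variable {F : Germ n} {F₀ : Big n ℂ} {g : Big n (Polynomial ℂ)}

/-- Both sides solve the same linear equation with the same initial value. For `α = n` the source is
itself a homogeneous solution, so Duhamel's formula reduces to multiplication by `s`. -/
lemma IsDeformation.smallHom_eq (hn : 2 ≤ n) (hF : IsFrobeniusPotential F)
    (hF₀ : IsDescendantPotential F F₀) (hg : IsDeformation F₀ g) (α : Fin n) (p : ℕ) :
    smallHom (dt p α (dt 0 0 g)) = flowSol (hamiltonian F₀ α p) +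
      if α = Fin.rev 0 then C Polynomial.X * flowSol (hamiltonian F₀ 0 (p + 1)) else 0 := by
  have hi (α : Fin n) (p : ℕ) : MvPowerSeries.map (evalS 0 : Polynomial ℂ →+* ℂ)
      (smallHom (dt p α (dt 0 0 g))) = hamiltonian F₀ α p := by
    rw [map_smallHom, map_dt, map_dt, hg.initial, hamiltonian_eq]
  have h1 (α : Fin n) (hα : α ≠ Fin.rev 0) (p : ℕ) :
      smallHom (dt p α (dt 0 0 g)) = flowSol (hamiltonian F₀ α p) := by
    rw [← sub_eq_zero]
    refine eq_zero_of_flow flowOp flowOp_C_mul ?_ ?_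
    · rw [map_sub, hg.flow_smallHom hn hF hF₀, if_neg hα, coeffDer_flowSol hn, flowOp_sub, add_zero]
    · rw [map_sub, hi, map_zero_flowSol, sub_self]
  split_ifs with hα
  · have hd : derS Polynomial.X = 1 := Polynomial.derivative_X
    have hX : (evalS 0 : Polynomial ℂ →+* ℂ) Polynomial.X = 0 := Polynomial.aeval_X _
    rw [← sub_eq_zero]
    refine eq_zero_of_flow flowOp flowOp_C_mul ?_ ?_
    · rw [map_sub, hg.flow_smallHom hn hF hF₀, if_pos hα, map_add, Derivation.leibniz,
        coeffDer_flowSol hn, coeffDer_flowSol hn, coeffDer_C, hd,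
        h1 0 (Ne.symm (rev_zero_ne hn)), flowOp_sub, flowOp_add, flowOp_C_mul, map_one, smul_eq_mul,
        smul_eq_mul]
      ring
    · rw [map_sub, hi, map_add, map_zero_flowSol, map_mul, map_C, hX]
      simp
  · rw [add_zero, h1 α hα]

lemma inv_vHat_last : (vHat (Fin.rev 0) : Germ n) * (vHat (Fin.rev 0))⁻¹ = 1 :=
  MvPowerSeries.mul_inv_cancel _ (by simp [vHat])

lemma vHat_last : (vHat (Fin.rev 0) : Germ n) = X (Fin.rev 0) - 1 := by
  simp [vHat, sub_eq_add_neg]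

lemma inv_vOfHat_last (hn : 2 ≤ n) : (vOfHat (Fin.rev 0) : Germ n)⁻¹ = 1 - X (Fin.rev 0) := by
  have h : (vOfHat (Fin.rev 0) : Germ n) = - (vHat (Fin.rev 0))⁻¹ := by
    rw [vOfHat, if_neg (rev_zero_ne hn), if_pos rfl]
  symm
  rw [MvPowerSeries.eq_inv_iff_mul_eq_one (by simp [h, vHat])]
  rw [h]
  have := inv_vHat_last (n := n)
  rw [vHat_last] at this ⊢
  linear_combination this

/-- Shifting the last coordinate by `-1` changes the form linearly, through its pairing with the
first; no constant appears since `η_{nn} = 0`. -/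
lemma quadForm_vHat (hn : 2 ≤ n) :
    quadForm (vHat (n := n)) = quadForm (fun γ : Fin n => X γ) - X 0 := by
  have h1 : ∑ γ : Fin n, (X γ : Germ n) * C (if γ.rev = Fin.rev 0 then (-1 : ℂ) else 0) =
      - X 0 := by
    rw [Finset.sum_eq_single 0]
    · simp
    · intro γ _ hγ
      rw [if_neg (fun h => hγ (Fin.rev_injective h)), map_zero, mul_zero]
    · simp
  have h2 : ∑ γ : Fin n, C (if γ = Fin.rev 0 then (-1 : ℂ) else 0) * (X γ.rev : Germ n) =
      - X 0 := by
    rw [Finset.sum_eq_single (Fin.rev 0)]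
    · simp
    · intro γ _ hγ
      rw [if_neg hγ, map_zero, zero_mul]
    · simp
  have h3 : ∑ γ : Fin n, C (if γ = Fin.rev 0 then (-1 : ℂ) else 0) *
      (C (if γ.rev = Fin.rev 0 then (-1 : ℂ) else 0) : Germ n) = 0 := by
    refine Finset.sum_eq_zero fun γ _ => ?_
    by_cases h : γ = Fin.rev 0
    · rw [h, Fin.rev_rev, if_neg (Ne.symm (rev_zero_ne hn)), map_zero, mul_zero]
    · rw [if_neg h, map_zero, zero_mul]
  have h4 (x : Germ n) : (1 / 2 : ℂ) • (-x + -x) = -x := by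
    rw [← two_smul ℂ, smul_smul]; norm_num
  simp only [quadForm, vHat, mul_add, add_mul, Finset.sum_add_distrib]
  rw [h1, h2, h3, add_zero, add_assoc, smul_add, h4, sub_eq_add_neg]

/-- In centred coordinates `1 - s v^n` becomes `-v̂^n` at `s = 1`. The time-one map is thus the
inverse inversion, recentred at the base point. -/
lemma map_one_coordS (hn : 2 ≤ n) (μ : Fin n) :
    MvPowerSeries.map (evalS 1 : Polynomial ℂ →+* ℂ) (coordS μ) =
      vOfHat μ - C (basePt n μ) := by
  have hX : (evalS 1 : Polynomial ℂ →+* ℂ) Polynomial.X = 1 := Polynomial.aeval_X _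
  have hI : MvPowerSeries.map (evalS 1 : Polynomial ℂ →+* ℂ) (scaleInv (n := n)) =
      - (vHat (Fin.rev 0))⁻¹ := by
    have h := congrArg (MvPowerSeries.map (evalS 1 : Polynomial ℂ →+* ℂ))
      (scaleS_mul_scaleInv (n := n))
    rw [map_mul, scaleS, map_sub, map_one, map_mul, map_C, hX, map_X, map_one, one_mul] at h
    have h' := inv_vHat_last (n := n)
    rw [vHat_last] at h' ⊢
    linear_combination - (X (Fin.rev 0) - 1)⁻¹ * h -
      (MvPowerSeries.map (evalS 1 : Polynomial ℂ →+* ℂ) (scaleInv (n := n))) * h'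
  have h' := inv_vHat_last (n := n)
  rw [coordS, vOfHat, basePt]
  split_ifs with h0 h1 h1
  · exact absurd (h1.symm.trans h0) (rev_zero_ne hn)
  · rw [map_mul, hI, map_sub, map_mul, map_C, hX, map_X, map_quadForm_X, map_one, map_zero,
      one_mul, ← smul_mul_assoc]
    change _ = quadForm (vHat (n := n)) * _ - _
    rw [quadForm_vHat hn]
    ring
  · rw [map_mul, hI, map_X, h1, map_one]
    rw [vHat_last] at h' ⊢
    linear_combination - h'
  · rw [map_mul, hI, map_X, map_zero, show (vHat μ : Germ n) = X μ by simp [vHat, h1]]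
    ring

lemma map_one_flowSol (hn : 2 ≤ n) (f : Germ n) :
    MvPowerSeries.map (evalS 1 : Polynomial ℂ →+* ℂ) (flowSol f) =
      (1 - X (Fin.rev 0)) * pullback f := by
  have hX : evalS 1 Polynomial.X = 1 := Polynomial.aeval_X _
  rw [map_flowSol, hX, map_one, one_mul, pullback]
  simp only [map_one_coordS hn]

lemma IsDeformation.hamiltonian_one (hn : 2 ≤ n) (hF : IsFrobeniusPotential F)
    (hF₀ : IsDescendantPotential F F₀) (hg : IsDeformation F₀ g) (α : Fin n) (p : ℕ) :
    hamiltonian (MvPowerSeries.map (evalS 1 : Polynomial ℂ →+* ℂ) g) α p =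
      (1 - X (Fin.rev 0)) * pullback (hamiltonian F₀ α p) +
        if α = Fin.rev 0 then (1 - X (Fin.rev 0)) * pullback (hamiltonian F₀ 0 (p + 1)) else 0 := by
  have hX : (evalS 1 : Polynomial ℂ →+* ℂ) Polynomial.X = 1 := Polynomial.aeval_X _
  rw [hamiltonian_eq, ← map_dt, ← map_dt, ← map_smallHom, hg.smallHom_eq hn hF hF₀, map_add,
    map_one_flowSol hn]
  split_ifs
  · rw [map_mul, map_one_flowSol hn, map_C, hX, map_one, one_mul]
  · rw [map_zero]

end ScalingSolution

end InversionHierarchy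
end

noncomputable section

namespace InversionHierarchy

open MvPowerSeries
open Finsupp hiding some

/-! ### Independence of the normalization of the Hamiltonians. -/

section PrincipalSystems

variable {n : ℕ}

lemma mem_hamSpan (θ : Fin n → ℕ → Germ n) (α : Fin n) (p : ℕ) : θ α p ∈ hamSpan θ :=
  Submodule.mem_sup_left (Submodule.subset_span ⟨(α, p), rfl⟩)

lemma one_mem_hamSpan (θ : Fin n → ℕ → Germ n) : (1 : Germ n) ∈ hamSpan θ :=
  Submodule.mem_sup_right (Submodule.mem_span_singleton_self 1)

lemma hamSpan_le_of_mem {θ : Fin n → ℕ → Germ n} {V : Submodule ℂ (Germ n)}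
    (h : ∀ α p, θ α p ∈ V) (h1 : (1 : Germ n) ∈ V) : hamSpan θ ≤ V :=
  sup_le (Submodule.span_le.mpr (by rintro _ ⟨x, rfl⟩; exact h x.1 x.2))
    (Submodule.span_le.mpr (by simpa using h1))

lemma C_eq_smul_one (c : ℂ) : (C c : Germ n) = c • 1 := by
  rw [smul_eq_C_mul, mul_one]

lemma C_mem_hamSpan (θ : Fin n → ℕ → Germ n) (c : ℂ) : (C c : Germ n) ∈ hamSpan θ := by
  rw [C_eq_smul_one]
  exact Submodule.smul_mem _ _ (one_mem_hamSpan θ)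

variable [NeZero n] {F : Germ n} {θ θ' : Fin n → ℕ → Germ n}

omit [NeZero n] in
lemma dv_X (α β : Fin n) : dv β (X α : Germ n) = C (eta α.rev β) := by
  by_cases h : α = β
  · rw [h, dv, pderiv_X_self, eta, Fin.rev_rev, if_pos rfl, map_one]
  · rw [dv, pderiv_X_of_ne h, eta, Fin.rev_rev, if_neg (Ne.symm h), map_zero]

omit [NeZero n] in
lemma IsPrincipalSystem.zero_eq (hθ : IsPrincipalSystem F θ) (α : Fin n) :
    θ α 0 = X α.rev + C (constantCoeff (θ α 0)) := by
  refine pderiv.ext (fun β => ?_) (by simp)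
  have h := dv_X α.rev β
  rw [Fin.rev_rev] at h
  rw [map_add, pderiv_C, add_zero]
  exact (hθ.initial α β).trans h.symm

omit [NeZero n] in
lemma IsPrincipalSystem.X_mem (hθ : IsPrincipalSystem F θ) (α : Fin n) :
    (X α : Germ n) ∈ hamSpan θ := by
  have h := hθ.zero_eq α.rev
  rw [Fin.rev_rev, ← sub_eq_iff_eq_add] at h
  rw [← h]
  exact Submodule.sub_mem _ (mem_hamSpan θ _ _) (C_mem_hamSpan θ _)

omit [NeZero n] in
lemma IsPrincipalSystem.mem_of_hessian_eq_zero (hθ : IsPrincipalSystem F θ) {f : Germ n}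
    (hf : ∀ l μ, dv l (dv μ f) = 0) : f ∈ hamSpan θ := by
  have h1 (μ : Fin n) : dv μ f = C (constantCoeff (dv μ f)) :=
    pderiv.ext (fun l => by rw [pderiv_C]; exact hf l μ) (by simp)
  have h2 : f = C (constantCoeff f) + ∑ μ, constantCoeff (dv μ f) • X μ := by
    refine pderiv.ext (fun l => ?_) ?_
    · rw [map_add, pderiv_C, zero_add, map_sum, Finset.sum_eq_single l]
      · rw [Derivation.map_smul, pderiv_X_self, ← C_eq_smul_one]
        exact h1 l
      · intro μ _ hμ
        rw [Derivation.map_smul, pderiv_X_of_ne hμ, smul_zero]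
      · simp
    · simp [smul_eq_C_mul]
  rw [h2]
  exact Submodule.add_mem _ (C_mem_hamSpan θ _)
    (Submodule.sum_mem _ fun μ _ => Submodule.smul_mem _ _ (hθ.X_mem μ))

/-- The right-hand side `c_{lμ}^ν ∂_ν f` of the recursion. -/
def recursionRhs (F : Germ n) (l μ : Fin n) (f : Germ n) : Germ n :=
  ∑ ν : Fin n, ∑ κ : Fin n, eta ν κ • (dv l (dv μ (dv κ F)) * dv ν f)

-- The condition is linear in `f`, so the recursion extends from the generators to the whole span;
-- constants have zero right-hand side.
omit [NeZero n] in
lemma IsPrincipalSystem.exists_next (hθ : IsPrincipalSystem F θ) {f : Germ n}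
    (hf : f ∈ hamSpan θ) :
    ∃ f' ∈ hamSpan θ, ∀ l μ, dv l (dv μ f') = recursionRhs F l μ f := by
  let V : Submodule ℂ (Germ n) :=
    { carrier := {f | ∃ f' ∈ hamSpan θ, ∀ l μ, dv l (dv μ f') = recursionRhs F l μ f}
      add_mem' := by
        rintro f g ⟨f', hf', hf⟩ ⟨g', hg', hg⟩
        refine ⟨f' + g', Submodule.add_mem _ hf' hg', fun l μ => ?_⟩
        simp only [dv, recursionRhs, map_add, mul_add, smul_add, Finset.sum_add_distrib] at hf hg ⊢
        rw [hf, hg]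
      zero_mem' := ⟨0, Submodule.zero_mem _, fun l μ => by simp [dv, recursionRhs]⟩
      smul_mem' := by
        rintro c f ⟨f', hf', hf⟩
        refine ⟨c • f', Submodule.smul_mem _ _ hf', fun l μ => ?_⟩
        simp only [dv, recursionRhs, Derivation.map_smul, mul_smul_comm, smul_comm _ c,
          ← Finset.smul_sum] at hf ⊢
        rw [hf] }
  have h : hamSpan θ ≤ V := hamSpan_le_of_mem
    (fun α p => ⟨θ α (p + 1), mem_hamSpan θ _ _, fun l μ => hθ.recursion α p l μ⟩)
    ⟨0, Submodule.zero_mem _, fun l μ => by simp [dv, recursionRhs]⟩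
  exact h hf

/-- By induction on `p`, a recursive successor of `θ' α p` exists in the span of `θ`. It differs
from `θ' α (p + 1)` by a function with zero Hessian, which is affine and hence a combination of `1`
and the `θ α 0`. -/
lemma IsPrincipalSystem.hamSpan_le (hθ : IsPrincipalSystem F θ) (hθ' : IsPrincipalSystem F θ') :
    hamSpan θ' ≤ hamSpan θ := by
  refine hamSpan_le_of_mem (fun α p => ?_) (one_mem_hamSpan θ)
  induction p with
  | zero =>
    rw [hθ'.zero_eq]
    exact Submodule.add_mem _ (hθ.X_mem _) (C_mem_hamSpan θ _)
  | succ p ih =>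
    obtain ⟨f, hf, h⟩ := hθ.exists_next ih
    rw [← sub_add_cancel (θ' α (p + 1)) f]
    refine Submodule.add_mem _ (hθ.mem_of_hessian_eq_zero fun l μ => ?_) hf
    rw [dv, dv, map_sub, map_sub, sub_eq_zero]
    exact (hθ'.recursion α p l μ).trans (h l μ).symm

lemma IsPrincipalSystem.hamSpan_eq (hθ : IsPrincipalSystem F θ) (hθ' : IsPrincipalSystem F θ') :
    hamSpan θ = hamSpan θ' :=
  le_antisymm (hθ'.hamSpan_le hθ) (hθ.hamSpan_le hθ')

variable {F₀ : Big n ℂ}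

omit [NeZero n] in
lemma dt_comm {R : Type} [CommRing R] (p q : ℕ) (α β : Fin n) (f : Big n R) :
    dt p α (dt q β f) = dt q β (dt p α f) := pderiv_comm _ _ _

omit [NeZero n] in
lemma IsDescendantPotential.smallHom_dt_third (hF₀ : IsDescendantPotential F F₀)
    (α β γ : Fin n) : smallHom (dt 0 α (dt 0 β (dt 0 γ F₀))) = dv α (dv β (dv γ F)) := by
  rw [smallHom_dt, smallHom_dt, smallHom_dt]
  exact hF₀.small_third α β γ

omit [NeZero n] in
lemma IsDescendantPotential.smallHom_trr (hF₀ : IsDescendantPotential F F₀) (p : ℕ)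
    (α β γ : Fin n) : smallHom (dt (p + 1) α (dt 0 β (dt 0 γ F₀))) =
      ∑ σ : Fin n, smallHom (dt p α (dt 0 σ.rev F₀)) * dv σ (dv β (dv γ F)) := by
  rw [hF₀.trr, sum_eta_smul, map_sum]
  exact Finset.sum_congr rfl fun σ _ => by rw [map_mul, hF₀.smallHom_dt_third]

/-- In the recursion the three-point function with an index `1` is the metric, so the sum collapses
to one two-point function. -/
lemma IsDescendantPotential.dv_hamiltonian_succ (hF : IsFrobeniusPotential F)
    (hF₀ : IsDescendantPotential F F₀) (α μ : Fin n) (p : ℕ) :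
    dv μ (hamiltonian F₀ α (p + 1)) = smallHom (dt p α (dt 0 μ F₀)) := by
  have h : dv μ (smallHom (dt (p + 1) α (dt 0 0 F₀))) =
      smallHom (dt (p + 1) α (dt 0 μ (dt 0 0 F₀))) := by
    rw [dv, ← smallHom_dt, dt_comm]
  rw [hamiltonian_eq, h, hF₀.smallHom_trr, Finset.sum_eq_single μ.rev]
  · have h1 : dv μ.rev (dv μ (dv 0 F)) = C (eta μ.rev μ) := by
      rw [← hF.unit, dv, dv, dv, pderiv_comm μ, pderiv_comm μ.rev]
    rw [h1, eta, Fin.rev_rev, if_pos rfl, map_one, mul_one]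
  · intro σ _ hσ
    have h1 : dv σ (dv μ (dv 0 F)) = C (eta σ μ) := by
      rw [← hF.unit, dv, dv, dv, pderiv_comm μ, pderiv_comm σ]
    rw [h1, eta, if_neg (fun h => hσ (by rw [h, Fin.rev_rev])), map_zero, mul_zero]
  · simp

lemma IsDescendantPotential.isPrincipalSystem (hF : IsFrobeniusPotential F)
    (hF₀ : IsDescendantPotential F F₀) : IsPrincipalSystem F (hamiltonian F₀) where
  initial α β := by
    rw [hamiltonian_eq, hF₀.small_flat hF, dv_X, Fin.rev_rev]
  recursion α p l μ := by
    have h : dv l (smallHom (dt p α (dt 0 μ F₀))) =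
        smallHom (dt p α (dt 0 l (dt 0 μ F₀))) := by
      rw [dv, ← smallHom_dt, dt_comm]
    rw [hF₀.dv_hamiltonian_succ hF, h, Finset.sum_comm]
    have hc (κ : Fin n) : dv l (dv μ (dv κ F)) = dv κ (dv l (dv μ F)) := by
      rw [dv, dv, dv, pderiv_comm μ, pderiv_comm l]
    have he : ∑ κ, ∑ ν : Fin n, eta ν κ • (dv l (dv μ (dv κ F)) * dv ν (hamiltonian F₀ α p)) =
        ∑ κ : Fin n, dv κ (dv l (dv μ F)) * dv κ.rev (hamiltonian F₀ α p) := by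
      rw [Finset.sum_comm, sum_eta_smul]
      exact Finset.sum_congr rfl fun κ _ => by rw [hc]
    rw [he]
    cases p with
    | zero =>
      rw [hF₀.smallHom_dt_third, Finset.sum_eq_single α]
      · rw [hamiltonian_eq, hF₀.small_flat hF, dv_X, Fin.rev_rev, eta, if_pos rfl, map_one, mul_one]
      · intro κ _ hκ
        rw [hamiltonian_eq, hF₀.small_flat hF, dv_X, Fin.rev_rev, eta,
          if_neg (fun h => hκ (Fin.rev_injective h)), map_zero, mul_zero]
      · simp
    | succ p =>
      rw [hF₀.smallHom_trr]
      refine Finset.sum_congr rfl fun σ _ => ?_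
      rw [hF₀.dv_hamiltonian_succ hF, mul_comm]

end PrincipalSystems

/-! ### Comparison of the two spans. -/

section Spans

variable {n : ℕ} [NeZero n] {F : Germ n} {θ : Fin n → ℕ → Germ n}

lemma hasSubst_pullback (hn : 2 ≤ n) :
    HasSubst fun α : Fin n => vOfHat α - C (basePt n α) := by
  have h := (hasSubst_coordS (n := n)).map (evalS 1 : Polynomial ℂ →+* ℂ)
  simpa only [map_one_coordS hn] using h

/-- A density `f(v)` divided by `v^n`, up to sign, as a function of `v̂`. -/
def scaledPullback (hn : 2 ≤ n) : Germ n →ₗ[ℂ] Germ n :=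
  (LinearMap.mulLeft ℂ (1 - X (Fin.rev 0))).comp (substAlgHom (hasSubst_pullback hn)).toLinearMap

lemma scaledPullback_apply (hn : 2 ≤ n) (f : Germ n) :
    scaledPullback hn f = (1 - X (Fin.rev 0)) * pullback f := by
  rw [pullback, ← substAlgHom_apply (hasSubst_pullback hn)]
  rfl

lemma scaledPullback_one (hn : 2 ≤ n) : scaledPullback hn (1 : Germ n) = 1 - X (Fin.rev 0) := by
  have h : (substAlgHom (hasSubst_pullback hn)).toLinearMap (1 : Germ n) = 1 :=
    map_one (substAlgHom (hasSubst_pullback hn))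
  rw [scaledPullback, LinearMap.comp_apply, h, LinearMap.mulLeft_apply, mul_one]

lemma scaledPullback_X (hn : 2 ≤ n) :
    scaledPullback hn (X (Fin.rev 0) : Germ n) = X (Fin.rev 0) := by
  have h : (vOfHat (Fin.rev 0) : Germ n) * (vOfHat (Fin.rev 0))⁻¹ = 1 :=
    MvPowerSeries.mul_inv_cancel _ (by
      rw [vOfHat, if_neg (rev_zero_ne hn), if_pos rfl]; simp [vHat])
  rw [inv_vOfHat_last hn] at h
  rw [scaledPullback_apply, pullback, subst_X (hasSubst_pullback hn), basePt, if_pos rfl, map_one]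
  linear_combination h

lemma lxz_zero_zero (hn : 2 ≤ n) (θ : Fin n → ℕ → Germ n) :
    lxz θ 0 0 = - scaledPullback hn 1 := by
  rw [lxz.eq_def, if_pos rfl, scaledPullback_one, inv_vOfHat_last hn]

lemma lxz_zero_succ (hn : 2 ≤ n) (θ : Fin n → ℕ → Germ n) (p : ℕ) :
    lxz θ 0 (p + 1) = - scaledPullback hn (θ (Fin.rev 0) p) := by
  rw [lxz.eq_def, if_pos rfl, scaledPullback_apply, inv_vOfHat_last hn, mul_comm]

lemma lxz_last (hn : 2 ≤ n) (θ : Fin n → ℕ → Germ n) (p : ℕ) :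
    lxz θ (Fin.rev 0) p = scaledPullback hn (θ 0 (p + 1)) := by
  rw [lxz.eq_def, if_neg (rev_zero_ne hn), if_pos rfl, scaledPullback_apply, inv_vOfHat_last hn, mul_comm]

lemma lxz_of_ne (hn : 2 ≤ n) (θ : Fin n → ℕ → Germ n) {α : Fin n} (h0 : α ≠ 0)
    (h1 : α ≠ Fin.rev 0) (p : ℕ) : lxz θ α p = scaledPullback hn (θ α p) := by
  rw [lxz.eq_def, if_neg h0, if_neg h1, scaledPullback_apply, inv_vOfHat_last hn, mul_comm]

/-- The constant is the image of `v^n`, which equals `1 + X_n` in centred coordinates. -/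
lemma IsPrincipalSystem.one_mem_map (hn : 2 ≤ n) (hθ : IsPrincipalSystem F θ) :
    (1 : Germ n) ∈ (hamSpan θ).map (scaledPullback hn) :=
  ⟨1 + X (Fin.rev 0), Submodule.add_mem _ (one_mem_hamSpan θ) (hθ.X_mem _), by
    rw [map_add, scaledPullback_one, scaledPullback_X, sub_add_cancel]⟩

lemma IsPrincipalSystem.hamSpan_lxz (hn : 2 ≤ n) (hθ : IsPrincipalSystem F θ) :
    hamSpan (lxz θ) = (hamSpan θ).map (scaledPullback hn) := by
  apply le_antisymm
  · have hm {f : Germ n} (hf : f ∈ hamSpan θ) :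
        scaledPullback hn f ∈ (hamSpan θ).map (scaledPullback hn) := Submodule.mem_map_of_mem hf
    refine hamSpan_le_of_mem (fun α p => ?_) (hθ.one_mem_map hn)
    by_cases h0 : α = 0
    · subst h0
      cases p with
      | zero => rw [lxz_zero_zero hn]; exact Submodule.neg_mem _ (hm (one_mem_hamSpan θ))
      | succ p => rw [lxz_zero_succ hn]; exact Submodule.neg_mem _ (hm (mem_hamSpan θ _ _))
    by_cases h1 : α = Fin.rev 0
    · rw [h1, lxz_last hn]; exact hm (mem_hamSpan θ _ _)
    · rw [lxz_of_ne hn θ h0 h1]; exact hm (mem_hamSpan θ _ _)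
  · have h1 : scaledPullback hn 1 ∈ hamSpan (lxz θ) := by
      rw [← neg_neg (scaledPullback hn 1), ← lxz_zero_zero hn θ]
      exact Submodule.neg_mem _ (mem_hamSpan _ _ _)
    rw [Submodule.map_le_iff_le_comap]
    refine hamSpan_le_of_mem (fun α p => ?_) h1
    rw [Submodule.mem_comap]
    by_cases hl : α = Fin.rev 0
    · rw [hl, ← neg_neg (scaledPullback hn _), ← lxz_zero_succ hn]
      exact Submodule.neg_mem _ (mem_hamSpan _ _ _)
    by_cases h0 : α = 0
    · subst h0
      cases p with
      | zero =>
        -- The density `θ_{1,0}` does not occur in the family of Liu, Xu and Zhang. Up to a constant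
        -- it is `v^n`, whose quotient by `v^n` is constant; the leftover constant contributes a
        -- multiple of `1/v^n`, supplied by the generator `(1,0)`.
        have hX : scaledPullback hn (X (Fin.rev 0)) = 1 - scaledPullback hn 1 := by
          rw [scaledPullback_X, scaledPullback_one, sub_sub_cancel]
        rw [hθ.zero_eq, map_add, hX, C_eq_smul_one, map_smul]
        exact Submodule.add_mem _ (Submodule.sub_mem _ (one_mem_hamSpan _) h1)
          (Submodule.smul_mem _ _ h1)
      | succ p => rw [← lxz_last hn]; exact mem_hamSpan _ _ _
    · rw [← lxz_of_ne hn θ h0 hl]; exact mem_hamSpan _ _ _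

/-- The substitution adding `θ_{1,p+1}` to `θ_{n,p}` is unitriangular. Here `1/v^n` is not a given
generator and is recovered as `1 - h 0 0`, for which the normalization `θ_{1,0} = v^n - 1` matters:
with `θ_{1,0} = v^n` the density `h 0 0` would be constant. -/
lemma IsPrincipalSystem.hamSpan_transformed (hn : 2 ≤ n) (hθ : IsPrincipalSystem F θ)
    (h00 : θ 0 0 = X (Fin.rev 0)) {h : Fin n → ℕ → Germ n}
    (hh : ∀ α p, h α p = scaledPullback hn (θ α p) +
      if α = Fin.rev 0 then scaledPullback hn (θ 0 (p + 1)) else 0) :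
    hamSpan h = (hamSpan θ).map (scaledPullback hn) := by
  have hne (α : Fin n) (hα : α ≠ Fin.rev 0) (p : ℕ) : h α p = scaledPullback hn (θ α p) := by
    rw [hh, if_neg hα, add_zero]
  have h0 := hne 0 (Ne.symm (rev_zero_ne hn))
  apply le_antisymm
  · have hm (α : Fin n) (p : ℕ) :
        scaledPullback hn (θ α p) ∈ (hamSpan θ).map (scaledPullback hn) :=
      Submodule.mem_map_of_mem (mem_hamSpan θ α p)
    refine hamSpan_le_of_mem (fun α p => ?_) (hθ.one_mem_map hn)
    rw [hh]
    refine Submodule.add_mem _ (hm α p) ?_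
    split_ifs
    · exact hm 0 (p + 1)
    · exact Submodule.zero_mem _
  · rw [Submodule.map_le_iff_le_comap]
    refine hamSpan_le_of_mem (fun α p => ?_) ?_
    · rw [Submodule.mem_comap]
      by_cases hl : α = Fin.rev 0
      · have : scaledPullback hn (θ α p) = h α p - h 0 (p + 1) := by
          rw [hh α p, if_pos hl, h0, add_sub_cancel_right]
        rw [this]
        exact Submodule.sub_mem _ (mem_hamSpan _ _ _) (mem_hamSpan _ _ _)
      · rw [← hne α hl]; exact mem_hamSpan _ _ _
    · have : scaledPullback hn 1 = 1 - h 0 0 := by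
        rw [h0, h00, scaledPullback_X, scaledPullback_one]
      rw [Submodule.mem_comap, this]
      exact Submodule.sub_mem _ (one_mem_hamSpan _) (mem_hamSpan _ _ _)

end Spans

/-! ### The genus zero part of the deformation. -/

section Transform

variable {n : ℕ} [NeZero n]

/-- Setting `ħ = 0` in the full hierarchy closes the equation in genus zero, because the Laplacian
carries a factor `ħ`. -/
lemma exists_isDeformation (hn : 2 ≤ n) {F₀ : Big n ℂ} (h₀ : VanishesOnAxis F₀) :
    ∃ g : Big n (Polynomial ℂ), IsDeformation F₀ g ∧
      ∀ G, IsRTransform F₀ G ↔ G = MvPowerSeries.map (evalS 1 : Polynomial ℂ →+* ℂ) g := by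
  obtain ⟨f, hf, hhj, hi⟩ := exists_hamiltonJacobi hn h₀
  have hc (m : ℕ × Fin n →₀ ℕ) : coeff m (MvPowerSeries.map PowerSeries.constantCoeff f) =
      PowerSeries.coeff 0 (coeff m f) := by
    rw [coeff_map, PowerSeries.coeff_zero_eq_constantCoeff_apply]
  refine ⟨MvPowerSeries.map PowerSeries.constantCoeff f, ⟨?_, ?_⟩, fun G => ?_⟩
  · rw [hjZero, ← map_constantCoeff_hjRhs]
    ext1 m
    rw [coeffDer_apply, coeff_coeffMap, hc, coeff_map,
      ← PowerSeries.coeff_zero_eq_constantCoeff_apply]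
    exact hhj m 0
  · ext m
    rw [coeff_map, hc]
    have h := hi m 0
    rw [if_pos rfl, ← Polynomial.coe_aeval_eq_eval] at h
    exact h
  · rw [isRTransform_iff hn hf hhj hi]
    have h : genusAtOne f 0 = MvPowerSeries.map (evalS 1 : Polynomial ℂ →+* ℂ)
        (MvPowerSeries.map PowerSeries.constantCoeff f) := by
      ext m
      rw [coeff_map, hc]
      rfl
    rw [h]

end Transform

end InversionHierarchy
end

theorem proposition5p1 {n : ℕ} [NeZero n] (hn : 2 ≤ n)
    (F : InversionHierarchy.Germ n) (hF : InversionHierarchy.IsFrobeniusPotential F)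
    (F₀ : InversionHierarchy.Big n ℂ) (hF₀ : InversionHierarchy.IsDescendantPotential F F₀) :
    (∀ (α : Fin n) (p : ℕ),
      InversionHierarchy.hamiltonian (InversionHierarchy.infDeform F₀) α p =
        InversionHierarchy.opU (InversionHierarchy.hamiltonian F₀ α p) +
          if α = Fin.rev 0 then InversionHierarchy.hamiltonian F₀ 0 (p + 1) else 0) ∧
    ∃ F₀' : InversionHierarchy.Big n ℂ,
      (∀ G, InversionHierarchy.IsRTransform F₀ G ↔ G = F₀') ∧
      ∀ θ : Fin n → ℕ → InversionHierarchy.Germ n,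
        InversionHierarchy.IsPrincipalSystem F θ →
        InversionHierarchy.hamSpan (InversionHierarchy.hamiltonian F₀') =
          InversionHierarchy.hamSpan (InversionHierarchy.lxz θ) := by
  refine ⟨InversionHierarchy.hamiltonian_infDeform hn hF hF₀, ?_⟩
  obtain ⟨g, hg, hR⟩ := InversionHierarchy.exists_isDeformation hn (hF₀.vanishesOnAxis hn hF)
  refine ⟨_, hR, fun θ hθ => ?_⟩
  have hp := hF₀.isPrincipalSystem hF
  rw [hθ.hamSpan_lxz hn, hθ.hamSpan_eq hp]
  refine hp.hamSpan_transformed hn ?_ fun α p => ?_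
  · rw [InversionHierarchy.hamiltonian_eq, hF₀.small_flat hF]
  · rw [hg.hamiltonian_one hn hF hF₀, InversionHierarchy.scaledPullback_apply,
      InversionHierarchy.scaledPullback_apply]
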